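/- Let $P$ be a closed region in the plane bounded by a simple closed curve consisting of axis-parallel segments with integral endpoints (an orthogonal polygon without holes, with integral vertices). For such a polygon $R$ let $\mathrm{OPCS}(R)$ be the minimum number of closed axis-parallel squares contained in $R$ whose union is $R$. A vertex of $P$ is convex if it subtends an angle of $90^\circ$ to the interior of $P$; a knob is an edge of $P$ with both endpoints convex; a non-knob convex vertex is a convex vertex that is not an endpoint of any knob. Let $v$ be a non-knob convex vertex of $P$, and let $S$ be the maximal corner square of $v$, that is, an axis-parallel square with $v\in S\subseteq P$ such that no axis-parallel square of larger area contained in $P$ contains $S$. For a connected component $C$ of $P\setminus S$, consider the set $I$ of those sides of $S$ (top $t$, bottom $b$, left $l$, right $r$) that meet the closure $\overline C$ in more than one point. For each of the twelve sets $I\in\{t,\ b,\ l,\ r,\ tr,\ br,\ tl,\ bl,\ trb,\ tlb,\ rbl,\ rtl\}$ let $Q_I$ be the union of all components $C$ for which this set of sides is exactly $I$ and for which $\overline C$ contains the common corner of every two adjacent sides in $I$. Let $\mathscr Q$ be the family of those $Q_I$ that are non-empty. Then: (1) for every $Q\in\mathscr Q$, the set $S\cup Q$ is a connected orthogonal polygon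 without holes (again with integral vertices); (2) $\displaystyle \mathrm{OPCS}(P)=\Bigl(\sum_{Q\in\mathscr Q}\mathrm{OPCS}(S\cup Q)\Bigr)-\bigl(|\mathscr Q|-1\bigr).$ -/

import Mathlib

namespace OPCS

noncomputable section

/-- The closed unit cell of the integer grid whose bottom-left corner is `c`. -/
def cell (c : ℤ × ℤ) : Set (ℝ × ℝ) :=
  Set.Icc (c.1 : ℝ) (c.1 + 1) ×ˢ Set.Icc (c.2 : ℝ) (c.2 + 1)

/-- `P` is (the closed region of) an orthogonal polygon without holes whose vertices are integral:
a finite union of closed unit grid cells with connected (in particular nonempty) interior and with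
connected complement (no holes). These are exactly the closed regions bounded by a simple closed
curve made of axis-parallel segments with integral endpoints: two cells of `P` that meet in a
lattice point whose other two cells are outside `P` would make one of the two sets disconnected. -/
def IsOrthogonalPolygon (P : Set (ℝ × ℝ)) : Prop :=
  (∃ F : Finset (ℤ × ℤ), P = ⋃ c ∈ F, cell c) ∧ IsConnected (interior P) ∧ IsConnected Pᶜ

/-- A nondegenerate axis-parallel segment `[a, b]` contained in the boundary of `P`. -/
def IsBoundarySegment (P : Set (ℝ × ℝ)) (a b : ℝ × ℝ) : Prop :=
  a ≠ b ∧ (a.1 = b.1 ∨ a.2 = b.2) ∧ segment ℝ a b ⊆ frontier P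

/-- `a` and `b` are the endpoints of an edge of `P`: a maximal segment of the boundary. -/
def IsEdge (P : Set (ℝ × ℝ)) (a b : ℝ × ℝ) : Prop :=
  IsBoundarySegment P a b ∧
    ∀ a' b', IsBoundarySegment P a' b' → segment ℝ a b ⊆ segment ℝ a' b' →
      segment ℝ a' b' = segment ℝ a b

/-- `v` is a convex vertex of `P`: near `v`, the region `P` is a quadrant with apex `v`, that is,
`v` subtends an angle of 90 degrees to the interior. The signs `σ`, `τ` say which quadrant. -/
def IsConvexVertex (P : Set (ℝ × ℝ)) (v : ℝ × ℝ) : Prop :=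
  ∃ σ τ : ℝ, (σ = 1 ∨ σ = -1) ∧ (τ = 1 ∨ τ = -1) ∧
    ∀ᶠ p in nhds v, p ∈ P ↔ 0 ≤ σ * (p.1 - v.1) ∧ 0 ≤ τ * (p.2 - v.2)

/-- A knob: an edge whose endpoints are both convex vertices. -/
def IsKnob (P : Set (ℝ × ℝ)) (a b : ℝ × ℝ) : Prop :=
  IsEdge P a b ∧ IsConvexVertex P a ∧ IsConvexVertex P b

/-- A convex vertex that is not an endpoint of a knob. -/
def IsNonKnobConvexVertex (P : Set (ℝ × ℝ)) (v : ℝ × ℝ) : Prop :=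
  IsConvexVertex P v ∧ ∀ a b, IsKnob P a b → v ≠ a ∧ v ≠ b

/-- An axis-parallel square, given by its bottom-left corner `(x, y)` and its side length. -/
structure Square where
  x : ℝ
  y : ℝ
  len : ℝ
  len_pos : 0 < len

/-- The four sides of a square. -/
inductive Side
  | top
  | bottom
  | left
  | right
  deriving DecidableEq

/-- The closed region of a square. -/
def Square.region (S : Square) : Set (ℝ × ℝ) :=
  Set.Icc S.x (S.x + S.len) ×ˢ Set.Icc S.y (S.y + S.len)

/-- The sides of a square, as closed segments. -/
def Square.side (S : Square) : Side → Set (ℝ × ℝ)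
  | .top => Set.Icc S.x (S.x + S.len) ×ˢ {S.y + S.len}
  | .bottom => Set.Icc S.x (S.x + S.len) ×ˢ {S.y}
  | .left => {S.x} ×ˢ Set.Icc S.y (S.y + S.len)
  | .right => {S.x + S.len} ×ˢ Set.Icc S.y (S.y + S.len)

/-- A valid square: one that is contained in `P`. -/
def IsValidSquare (P : Set (ℝ × ℝ)) (S : Square) : Prop :=
  S.region ⊆ P

/-- A maximal square: a valid square such that no valid square with a larger area contains it. -/
def IsMaximalSquare (P : Set (ℝ × ℝ)) (S : Square) : Prop :=
  IsValidSquare P S ∧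
    ∀ T : Square, IsValidSquare P T → S.region ⊆ T.region → ¬ S.len ^ 2 < T.len ^ 2

/-- `S` is the maximal corner square of `v` in `P`: the maximal square that covers `v`. -/
def IsMaximalCornerSquare (P : Set (ℝ × ℝ)) (v : ℝ × ℝ) (S : Square) : Prop :=
  IsMaximalSquare P S ∧ v ∈ S.region

/-- The finite set `C` of squares covers `P`: all are valid and together they cover `P`. -/
def IsCovering (P : Set (ℝ × ℝ)) (C : Finset Square) : Prop :=
  (∀ T ∈ C, IsValidSquare P T) ∧ P ⊆ ⋃ T ∈ C, T.region

/-- `OPCS(P)`, the minimum number of squares in a covering of `P`. -/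
def opcs (P : Set (ℝ × ℝ)) : ℕ :=
  sInf {k | ∃ C : Finset Square, IsCovering P C ∧ C.card = k}

/-- The minimum in the definition of `opcs` is attained. -/
theorem IsOrthogonalPolygon.exists_covering {P : Set (ℝ × ℝ)} (hP : IsOrthogonalPolygon P) :
    ∃ C : Finset Square, IsCovering P C ∧ C.card = opcs P := by
  classical
  obtain ⟨⟨F, rfl⟩, -, -⟩ := hP
  refine Nat.sInf_mem (s := {k | ∃ C : Finset Square, IsCovering _ C ∧ C.card = k})
    ⟨_, F.image fun c => ⟨c.1, c.2, 1, one_pos⟩, ⟨?_, ?_⟩, rfl⟩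
  · intro T hT
    obtain ⟨c, hc, rfl⟩ := Finset.mem_image.1 hT
    exact Set.subset_biUnion_of_mem (u := cell) hc
  · intro p hp
    obtain ⟨c, hc, hpc⟩ := Set.mem_iUnion₂.1 hp
    exact Set.mem_iUnion₂.2 ⟨_, Finset.mem_image_of_mem _ hc, hpc⟩

/-- The connected components of `P` outside `S`. -/
def components (P : Set (ℝ × ℝ)) (S : Square) : Set (Set (ℝ × ℝ)) :=
  {C | ∃ p ∈ P \ S.region, C = connectedComponentIn (P \ S.region) p}

/-- The component `C` is of type `I`, for a set `I` of sides of `S`: the sides that `C` touches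
in more than one point are exactly those in `I`, and `C` touches `S` at the common corner of any
two adjacent sides in `I`. (Since `C` is disjoint from `S`, "touching" refers to the closure of
`C`. Opposite sides have no common point.) -/
def HasType (S : Square) (I : Finset Side) (C : Set (ℝ × ℝ)) : Prop :=
  (∀ d, (closure C ∩ S.side d).Nontrivial ↔ d ∈ I) ∧
    ∀ d ∈ I, ∀ d' ∈ I, d ≠ d' → S.side d ∩ S.side d' ⊆ closure C

/-- The twelve types: a single side, two adjacent sides, or three sides. -/
def types : Finset (Finset Side) :=
  {{.top}, {.bottom}, {.left}, {.right},
    {.top, .right}, {.bottom, .right}, {.top, .left}, {.bottom, .left},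
    {.top, .right, .bottom}, {.top, .left, .bottom},
    {.right, .bottom, .left}, {.right, .top, .left}}

/-- The class `Q_I`: the union of all components of type `I`. -/
def part (P : Set (ℝ × ℝ)) (S : Square) (I : Finset Side) : Set (ℝ × ℝ) :=
  ⋃₀ {C ∈ components P S | HasType S I C}

open Classical in
/-- The family of the nonempty ones among the twelve classes. -/
def parts (P : Set (ℝ × ℝ)) (S : Square) : Finset (Set (ℝ × ℝ)) :=
  (types.image (part P S)).filter Set.Nonempty

end

end OPCS

/-! A valid square that contains `v` has `v` as a corner, so it lies in `S`. In any covering the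
square at `v` can therefore be traded for `S`, and the remaining squares only have to cover `P \ S`.
If `T` is a valid square, then `T \ S` is connected, because a square that sticks out of `S` on two
opposite sides is longer than `S` and so sticks out on a third (`isPreconnected_region_diff`). Hence
`T \ S` lies in one component of `P \ S`, and so in one class `Q`. Consequently OPCS minus one is
additive: OPCS(P) - 1 is the sum of OPCS(S ∪ Q) - 1 over the classes (`opcs_decomposition`).

This requires the classes to partition `P \ S`. They are disjoint because a component determines its
set of sides. That every component has one of the twelve types (`exists_type`) is a Jordan curve
argument on grid cells. `S` is a box of cells; by symmetry let `v` be its bottom left corner. If a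
component touches the rim of `S` along two unit edges, a closed curve through the component and the
box crosses the rim exactly there, and it separates `v` from the rim points on the arc between the
two edges that avoids `v`. Since `v` is a corner of a cell outside `P`, and the complement of `P` is
connected and never met by the curve, no cell outside `P` touches that arc; so the component fills
the whole outside of the arc (`outerCell_mem_of_between`). The sides it touches thus form a run that
avoids `v` and includes the corners in between. A run from one side at `v` to the other would
surround `S` by cells of `P` and allow a larger square, so it cannot occur.

Separation is expressed by mod 2 flows between cells: a flow without divergence has a potential on
the lattice points (`exists_potential`), which plays the role of a winding number mod 2.

For the shape of `S ∪ Q`: paths in `P` from `Q` to `S` stay in `Q` until they enter `S`, and a cell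
outside `S ∪ Q` escapes from `P` along a straight ray that misses `S` (`isOrthogonalPolygon_union`).
-/

namespace OPCS

/-! ### Flows mod 2 between grid cells, potentials, and the absence of pinches. -/

section

/-- Two grid cells are adjacent if they share an edge. -/
def Adj (c d : ℤ × ℤ) : Prop :=
  (c.1 = d.1 ∧ (c.2 = d.2 + 1 ∨ d.2 = c.2 + 1)) ∨ (c.2 = d.2 ∧ (c.1 = d.1 + 1 ∨ d.1 = c.1 + 1))

/-- Adjacency inside a set of cells. -/
def AdjIn (A : Set (ℤ × ℤ)) (c d : ℤ × ℤ) : Prop := c ∈ A ∧ d ∈ A ∧ Adj c d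

/-- A set of cells is edge-connected. -/
def EdgeConn (A : Set (ℤ × ℤ)) : Prop := ∀ c ∈ A, ∀ d ∈ A, Relation.ReflTransGen (AdjIn A) c d

theorem Adj.symm {c d : ℤ × ℤ} (h : Adj c d) : Adj d c := by
  unfold Adj at *; omega

theorem AdjIn.symm {A : Set (ℤ × ℤ)} {c d : ℤ × ℤ} (h : AdjIn A c d) : AdjIn A d c :=
  ⟨h.2.1, h.1, h.2.2.symm⟩

theorem AdjIn.mono {A B : Set (ℤ × ℤ)} (hAB : A ⊆ B) {c d : ℤ × ℤ} (h : AdjIn A c d) :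
    AdjIn B c d := ⟨hAB h.1, hAB h.2.1, h.2.2⟩

theorem reach_symm {A : Set (ℤ × ℤ)} {c d : ℤ × ℤ} (h : Relation.ReflTransGen (AdjIn A) c d) :
    Relation.ReflTransGen (AdjIn A) d c := by
  have : Std.Symm (AdjIn A) := ⟨fun _ _ h => h.symm⟩
  exact Std.Symm.symm _ _ h

theorem reach_mono {A B : Set (ℤ × ℤ)} (hAB : A ⊆ B) {c d : ℤ × ℤ}
    (h : Relation.ReflTransGen (AdjIn A) c d) : Relation.ReflTransGen (AdjIn B) c d :=
  Relation.ReflTransGen.mono (fun _ _ => AdjIn.mono hAB) _ _ h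

/-- The divergence modulo two at a cell of a flow across the edges between adjacent cells. -/
def divergence (f : ℤ × ℤ → ℤ × ℤ → ZMod 2) (x y : ℤ) : ZMod 2 :=
  f (x - 1, y) (x, y) + f (x, y) (x + 1, y) + f (x, y - 1) (x, y) + f (x, y) (x, y + 1)

/-- The unit flow across one edge. -/
def edgeFlow (c d : ℤ × ℤ) (p q : ℤ × ℤ) : ZMod 2 :=
  if (p = c ∧ q = d) ∨ (p = d ∧ q = c) then 1 else 0

/-- The indicator of a cell modulo two. -/
def ind (c : ℤ × ℤ) (x y : ℤ) : ZMod 2 := if (x, y) = c then 1 else 0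

theorem divergence_edgeFlow {c d : ℤ × ℤ} (h : Adj c d) (x y : ℤ) :
    divergence (edgeFlow c d) x y = ind c x y + ind d x y := by
  obtain ⟨c1, c2⟩ := c
  obtain ⟨d1, d2⟩ := d
  simp only [Adj] at h
  simp only [divergence, edgeFlow, ind, Prod.mk.injEq]
  have two : (1 : ZMod 2) + 1 = 0 := by decide
  rcases h with ⟨h1, h2 | h2⟩ | ⟨h1, h2 | h2⟩ <;> by_cases hx : x = c1 <;>
    by_cases hy : y = c2 <;> grind

theorem divergence_add (f g : ℤ × ℤ → ℤ × ℤ → ZMod 2) (x y : ℤ) :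
    divergence (fun p q => f p q + g p q) x y = divergence f x y + divergence g x y := by
  simp only [divergence]; ring

/-- A flow vanishes above some height. -/
def BoundedFlow (f : ℤ × ℤ → ℤ × ℤ → ZMod 2) : Prop :=
  ∃ M : ℤ, ∀ p q : ℤ × ℤ, M ≤ q.2 → f p q = 0

theorem BoundedFlow.add {f g : ℤ × ℤ → ℤ × ℤ → ZMod 2} (hf : BoundedFlow f)
    (hg : BoundedFlow g) : BoundedFlow (fun p q => f p q + g p q) := by
  obtain ⟨M, hM⟩ := hf
  obtain ⟨N, hN⟩ := hg
  exact ⟨max M N, fun p q h => by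
    simp [hM p q (le_trans (le_max_left _ _) h), hN p q (le_trans (le_max_right _ _) h)]⟩

theorem boundedFlow_edgeFlow (c d : ℤ × ℤ) : BoundedFlow (edgeFlow c d) := by
  refine ⟨max c.2 d.2 + 1, fun p q h => if_neg ?_⟩
  rintro (⟨-, rfl⟩ | ⟨-, rfl⟩) <;> omega

/-- The flow is the sum of the unit flows along a path; the divergences at its intermediate cells
cancel mod 2. -/
theorem exists_flow {A : Set (ℤ × ℤ)} {c d : ℤ × ℤ} (h : Relation.ReflTransGen (AdjIn A) c d) :
    ∃ f, BoundedFlow f ∧ (∀ p q, f p q ≠ 0 → p ∈ A ∧ q ∈ A) ∧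
      ∀ x y, divergence f x y = ind c x y + ind d x y := by
  induction h with
  | refl => exact ⟨fun _ _ => 0, ⟨0, by simp⟩, by simp, fun x y => by
      simp [divergence, CharTwo.add_self_eq_zero]⟩
  | @tail e d _ hed ih =>
    obtain ⟨f, hb, hs, hdiv⟩ := ih
    refine ⟨fun p q => f p q + edgeFlow e d p q, hb.add (boundedFlow_edgeFlow _ _), ?_, ?_⟩
    · intro p q hpq
      by_cases hf : f p q = 0
      · simp only [hf, zero_add, edgeFlow, ne_eq, ite_eq_right_iff, one_ne_zero, imp_false,
          not_not] at hpq
        rcases hpq with ⟨rfl, rfl⟩ | ⟨rfl, rfl⟩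
        · exact ⟨hed.1, hed.2.1⟩
        · exact ⟨hed.2.1, hed.1⟩
      · exact hs p q hf
    · intro x y
      rw [divergence_add, hdiv, divergence_edgeFlow hed.2.2]
      have := CharTwo.add_self_eq_zero (ind e x y)
      linear_combination this

/-- A circulation has a potential on the lattice points, which jumps across the edges by the
value of the flow. -/
theorem exists_potential {f : ℤ × ℤ → ℤ × ℤ → ZMod 2} (hb : BoundedFlow f)
    (hdiv : ∀ x y, divergence f x y = 0) :
    ∃ w : ℤ → ℤ → ZMod 2, (∀ x y, w x y + w x (y + 1) = f (x - 1, y) (x, y)) ∧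
      ∀ x y, w x y + w (x + 1) y = f (x, y - 1) (x, y) := by
  obtain ⟨M, hM⟩ := hb
  -- `w x y` counts the flow across the vertical ray going up from `(x, y)`; by boundedness the sum
  -- can stop at height `M`.
  set w : ℤ → ℤ → ZMod 2 := fun x y => ∑ j ∈ Finset.Ico y M, f (x - 1, j) (x, j) with hw
  have h1 : ∀ x y, w x y = f (x - 1, y) (x, y) + w x (y + 1) := by
    intro x y
    simp only [hw]
    by_cases hy : y < M
    · have : Finset.Ico y M = insert y (Finset.Ico (y + 1) M) := by
        ext z; simp only [Finset.mem_Ico, Finset.mem_insert]; omega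
      rw [this, Finset.sum_insert (by simp)]
    · rw [Finset.Ico_eq_empty (by omega), Finset.Ico_eq_empty (by omega),
        hM _ _ (by simpa using hy)]
      simp
  have h0 : ∀ x y, M ≤ y → w x y = 0 := by
    intro x y hy
    simp only [hw]
    rw [Finset.Ico_eq_empty (by omega), Finset.sum_empty]
  refine ⟨w, fun x y => ?_, fun x y => ?_⟩
  · have := CharTwo.add_self_eq_zero (w x (y + 1))
    linear_combination h1 x y + this
  -- Downward induction on the height: above `M` everything vanishes, and zero divergence at the
  -- cell `(x, y)` carries the relation from its top edge to its bottom edge.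
  · have key : ∀ k : ℕ, ∀ y, M ≤ y + k → w x y + w (x + 1) y = f (x, y - 1) (x, y) := by
      intro k
      induction k with
      | zero =>
        intro y hy
        rw [h0 x y (by simpa using hy), h0 _ y (by simpa using hy), hM _ _ (by simpa using hy)]
        simp
      | succ k ih =>
        intro y hy
        have h2 := ih (y + 1) (by push_cast at hy; omega)
        have h3 := hdiv x y
        simp only [divergence] at h3
        have e1 := h1 x y
        have e2 := h1 (x + 1) y
        rw [add_sub_cancel_right] at e2 h2
        have c1 := CharTwo.add_self_eq_zero (f (x, y) (x, y + 1))
        have c2 := CharTwo.add_self_eq_zero (f (x, y - 1) (x, y))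
        linear_combination e1 + e2 + h2 + h3 - c2
    exact key (M - y).toNat y (by omega)

/-- In a region and a complement that are both edge-connected, two diagonal cells of the region
do not meet in a pinch. -/
theorem not_pinch_aux {A : Set (ℤ × ℤ)} (hA : EdgeConn A) (hAc : EdgeConn Aᶜ) {x y : ℤ}
    (h00 : (x, y) ∈ A) (h11 : (x + 1, y + 1) ∈ A) (h10 : (x + 1, y) ∉ A)
    (h01 : (x, y + 1) ∉ A) : False := by
  obtain ⟨f, hb, hs, hdiv⟩ := exists_flow (hA _ h00 _ h11)
  have a1 : Adj (x, y) (x, y + 1) := by simp [Adj]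
  have a2 : Adj (x, y + 1) (x + 1, y + 1) := by simp [Adj]
  -- The path inside `A` is closed up through the cell `(x, y + 1)`, which is entered by its bottom
  -- edge and left by its right edge.
  obtain ⟨w, hv, hh⟩ := exists_potential
    (hb.add ((boundedFlow_edgeFlow (x, y) (x, y + 1)).add
      (boundedFlow_edgeFlow (x, y + 1) (x + 1, y + 1)))) (fun s t => by
        rw [divergence_add, divergence_add, hdiv, divergence_edgeFlow a1, divergence_edgeFlow a2]
        have c1 := CharTwo.add_self_eq_zero (ind (x, y) s t)
        have c2 := CharTwo.add_self_eq_zero (ind (x, y + 1) s t)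
        have c3 := CharTwo.add_self_eq_zero (ind (x + 1, y + 1) s t)
        linear_combination c1 + c2 + c3)
  have hf : ∀ p q, p ∉ A ∨ q ∉ A → f p q = 0 := by
    intro p q h
    by_contra h'
    have := hs p q h'
    tauto
  have eqz : ∀ a b : ZMod 2, a + b = 0 → a = b := by decide
  have nez : ∀ a b : ZMod 2, a + b = 1 → a ≠ b := by decide
  -- The potential is read at upper left corners: moving between these crosses only left and top
  -- edges of cells outside `A`, and the closing curve uses neither.
  have hconst : ∀ p ∈ Aᶜ, ∀ q ∈ Aᶜ, Adj p q → w p.1 (p.2 + 1) = w q.1 (q.2 + 1) := by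
    have up : ∀ s t, (s, t) ∉ A → (s, t + 1) ∉ A → w s (t + 1) = w s (t + 1 + 1) := by
      intro s t h1 h2
      apply eqz
      rw [hv, hf _ _ (Or.inr h2)]
      simp only [edgeFlow, Prod.mk.injEq]
      rw [if_neg, if_neg]
      · simp
      · rintro (⟨_, hst⟩ | ⟨_, hst⟩)
        · exact h2 (by rw [hst.1, hst.2]; exact h11)
        · omega
      · rintro (⟨_, hst⟩ | ⟨_, hst⟩)
        · omega
        · exact h2 (by rw [hst.1, hst.2]; exact h00)
    have right : ∀ s t, (s, t) ∉ A → (s + 1, t) ∉ A → w s (t + 1) = w (s + 1) (t + 1) := by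
      intro s t h1 h2
      apply eqz
      rw [hh, add_sub_cancel_right, hf _ _ (Or.inl h1)]
      simp only [edgeFlow, Prod.mk.injEq]
      rw [if_neg, if_neg]
      · simp
      · rintro (⟨_, hst⟩ | ⟨_, hst⟩)
        · omega
        · omega
      · rintro (⟨hst, _⟩ | ⟨hst, _⟩)
        · exact h1 (by rw [hst.1, hst.2]; exact h00)
        · omega
    rintro ⟨p1, p2⟩ hp ⟨q1, q2⟩ hq hpq
    simp only [Adj] at hpq
    rcases hpq with ⟨rfl, rfl | rfl⟩ | ⟨rfl, rfl | rfl⟩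
    · exact (up _ _ hq hp).symm
    · exact up _ _ hp hq
    · exact (right _ _ hq hp).symm
    · exact right _ _ hp hq
  have hpath := hAc _ h10 _ h01
  have heq : w (x + 1) (y + 1) = w x (y + 1 + 1) := by
    have : ∀ q, Relation.ReflTransGen (AdjIn Aᶜ) (x + 1, y) q →
        w (x + 1) (y + 1) = w q.1 (q.2 + 1) := by
      intro q hq
      induction hq with
      | refl => rfl
      | tail _ h ih => exact ih.trans (hconst _ h.1 _ h.2.1 h.2.2)
    exact this _ hpath
  -- The left edge of `(x, y + 1)` is not crossed, so the potential agrees at the two ends of its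
  -- bottom edge; but that edge is crossed exactly once.
  have e1 : w x (y + 1) = w x (y + 1 + 1) := by
    apply eqz
    rw [hv, hf _ _ (Or.inr h01)]
    simp [edgeFlow]
    omega
  refine nez (w x (y + 1)) (w (x + 1) (y + 1)) ?_ (e1.trans heq.symm)
  rw [hh, hf _ _ (Or.inr h01)]
  simp [edgeFlow]

/-- The four diagonal positions reduce to one by exchanging the two cells and by exchanging `A` with
its complement, as the hypotheses are symmetric in both. -/
theorem not_pinch {A : Set (ℤ × ℤ)} (hA : EdgeConn A) (hAc : EdgeConn Aᶜ) {x y s t : ℤ}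
    (hs : s = x + 1 ∨ x = s + 1) (ht : t = y + 1 ∨ y = t + 1)
    (h1 : (x, y) ∈ A) (h2 : (s, t) ∈ A) : (s, y) ∈ A ∨ (x, t) ∈ A := by
  by_contra! h
  have hA' : EdgeConn Aᶜᶜ := by rwa [compl_compl]
  have n1 : (x, y) ∉ Aᶜ := fun h => h h1
  have n2 : (s, t) ∉ Aᶜ := fun h => h h2
  rcases hs with rfl | rfl <;> rcases ht with rfl | rfl
  · exact not_pinch_aux hA hAc h1 h2 h.1 h.2
  · exact not_pinch_aux hAc hA' h.2 h.1 n2 n1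
  · exact not_pinch_aux hAc hA' h.1 h.2 n1 n2
  · exact not_pinch_aux hA hAc h2 h1 h.2 h.1

end

/-! ### The potential along the rim of a box. -/

section

/-- The cells of an `n × n` square. -/
def box (a b n : ℤ) : Set (ℤ × ℤ) := {c | (a ≤ c.1 ∧ c.1 < a + n) ∧ b ≤ c.2 ∧ c.2 < b + n}

theorem edgeConn_box (a b n : ℤ) : EdgeConn (box a b n) := by
  have hx : ∀ (k : ℕ) (x y : ℤ), (x, y) ∈ box a b n → (x + k, y) ∈ box a b n →
      Relation.ReflTransGen (AdjIn (box a b n)) (x, y) (x + k, y) := by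
    intro k x y h1 h2
    induction k with
    | zero => simp [Relation.ReflTransGen.refl]
    | succ k ih =>
      have h3 : (x + k, y) ∈ box a b n := by
        simp only [box, Set.mem_ofPred_eq] at *; push_cast at h2; omega
      exact (ih h3).tail ⟨h3, h2, by simp only [Adj, true_and]; push_cast; omega⟩
  have hy : ∀ (k : ℕ) (x y : ℤ), (x, y) ∈ box a b n → (x, y + k) ∈ box a b n →
      Relation.ReflTransGen (AdjIn (box a b n)) (x, y) (x, y + k) := by
    intro k x y h1 h2
    induction k with
    | zero => simp [Relation.ReflTransGen.refl]
    | succ k ih =>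
      have h3 : (x, y + k) ∈ box a b n := by
        simp only [box, Set.mem_ofPred_eq] at *; push_cast at h2; omega
      exact (ih h3).tail ⟨h3, h2, by simp only [Adj, true_and]; push_cast; omega⟩
  have h0 : ∀ c ∈ box a b n, Relation.ReflTransGen (AdjIn (box a b n)) (a, b) c := by
    rintro ⟨x, y⟩ h
    have h' := h
    simp only [box, Set.mem_ofPred_eq] at h'
    have h1 := hx (x - a).toNat a b (by simp only [box, Set.mem_ofPred_eq]; omega)
      (by simp only [box, Set.mem_ofPred_eq]; omega)
    have h2 := hy (y - b).toNat x b (by simp only [box, Set.mem_ofPred_eq]; omega)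
      (by simp only [box, Set.mem_ofPred_eq]; omega)
    rw [show a + ((x - a).toNat : ℤ) = x by omega] at h1
    rw [show b + ((y - b).toNat : ℤ) = y by omega] at h2
    exact h1.trans h2
  intro c hc d hd
  exact (reach_symm (h0 c hc)).trans (h0 d hd)

/-- The lattice point `(x, y)` is a corner of the cell `c`. -/
def IsCorner (c : ℤ × ℤ) (x y : ℤ) : Prop := (x = c.1 ∨ x = c.1 + 1) ∧ (y = c.2 ∨ y = c.2 + 1)

/-- Two cells next to a set `B` that are joined by a path in `F` outside `B` give a two-valued
function on the lattice points, which is constant on the corners of the cells outside `F`, and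
which jumps along the boundary of `B` exactly at the two edges between `B` and the given cells. -/
theorem exists_boundary_potential {F B : Set (ℤ × ℤ)} (hFc : EdgeConn Fᶜ) (hB : EdgeConn B)
    (hBF : B ⊆ F) {r₁ r₂ s₁ s₂ : ℤ × ℤ} (hr : Relation.ReflTransGen (AdjIn (F \ B)) r₁ r₂)
    (hr₁ : r₁ ∈ F) (hr₂ : r₂ ∈ F)
    (hs₁ : s₁ ∈ B) (hs₂ : s₂ ∈ B) (h₁ : Adj r₁ s₁) (h₂ : Adj r₂ s₂) :
    ∃ w : ℤ → ℤ → ZMod 2,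
      (∀ p ∉ F, ∀ q ∉ F, ∀ x y s t, IsCorner p x y → IsCorner q s t → w x y = w s t) ∧
      (∀ x y, ((x - 1, y) ∈ B ↔ (x, y) ∉ B) → w x y + w x (y + 1) =
        edgeFlow r₁ s₁ (x - 1, y) (x, y) + edgeFlow r₂ s₂ (x - 1, y) (x, y)) ∧
      (∀ x y, ((x, y - 1) ∈ B ↔ (x, y) ∉ B) → w x y + w (x + 1) y =
        edgeFlow r₁ s₁ (x, y - 1) (x, y) + edgeFlow r₂ s₂ (x, y - 1) (x, y)) := by
  obtain ⟨f, hfb, hfs, hfd⟩ := exists_flow hr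
  obtain ⟨g, hgb, hgs, hgd⟩ := exists_flow (hB _ hs₁ _ hs₂)
  -- The closed curve runs from `r₁` to `r₂` outside `B`, steps to `s₂`, returns to `s₁` inside `B`
  -- and steps back to `r₁`. It stays in `F`, and it changes between `B` and its outside only at the
  -- two single steps.
  obtain ⟨w, hv, hh⟩ := exists_potential
    ((hfb.add hgb).add ((boundedFlow_edgeFlow r₁ s₁).add (boundedFlow_edgeFlow r₂ s₂)))
    (fun x y => by
      rw [divergence_add, divergence_add, divergence_add, hfd, hgd, divergence_edgeFlow h₁,
        divergence_edgeFlow h₂]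
      have c1 := CharTwo.add_self_eq_zero (ind r₁ x y)
      have c2 := CharTwo.add_self_eq_zero (ind r₂ x y)
      have c3 := CharTwo.add_self_eq_zero (ind s₁ x y)
      have c4 := CharTwo.add_self_eq_zero (ind s₂ x y)
      linear_combination c1 + c2 + c3 + c4)
  have eqz : ∀ a b : ZMod 2, a + b = 0 → a = b := by decide
  have hf0 : ∀ p q, p ∉ F \ B ∨ q ∉ F \ B → f p q = 0 := by
    intro p q h; by_contra h'; have := hfs p q h'; tauto
  have hg0 : ∀ p q, p ∉ B ∨ q ∉ B → g p q = 0 := by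
    intro p q h; by_contra h'; have := hgs p q h'; tauto
  have he0 : ∀ r ∈ F, ∀ s ∈ B, ∀ p q, p ∉ F ∨ q ∉ F → edgeFlow r s p q = 0 := by
    intro r hr s hs p q h
    refine if_neg ?_
    have := hBF hs
    rintro (⟨rfl, rfl⟩ | ⟨rfl, rfl⟩) <;> tauto
  refine ⟨w, ?_, ?_, ?_⟩
  · have h0 : ∀ p q, p ∉ F ∨ q ∉ F →
        f p q + g p q + (edgeFlow r₁ s₁ p q + edgeFlow r₂ s₂ p q) = 0 := by
      intro p q h
      rw [hf0 p q (h.imp (fun h h' => h h'.1) (fun h h' => h h'.1)),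
        hg0 p q (h.imp (fun h h' => h (hBF h')) (fun h h' => h (hBF h'))),
        he0 _ hr₁ _ hs₁ p q h, he0 _ hr₂ _ hs₂ p q h]
      simp
    have cell_const : ∀ p ∉ F, ∀ x y, IsCorner p x y → w x y = w p.1 p.2 := by
      rintro ⟨p1, p2⟩ hp x y ⟨hx, hy⟩
      have e1 : w p1 p2 = w p1 (p2 + 1) := eqz _ _ (by rw [hv]; exact h0 _ _ (Or.inr hp))
      have e2 : w p1 p2 = w (p1 + 1) p2 := eqz _ _ (by rw [hh]; exact h0 _ _ (Or.inr hp))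
      have e3 : w p1 (p2 + 1) = w (p1 + 1) (p2 + 1) :=
        eqz _ _ (by rw [hh, add_sub_cancel_right]; exact h0 _ _ (Or.inl hp))
      simp only at hx hy
      rcases hx with rfl | rfl <;> rcases hy with rfl | rfl
      · rfl
      · exact e1.symm
      · exact e2.symm
      · exact (e1.trans e3).symm
    have adj_const : ∀ p ∉ F, ∀ q ∉ F, Adj p q → w p.1 p.2 = w q.1 q.2 := by
      rintro ⟨p1, p2⟩ hp ⟨q1, q2⟩ hq h
      simp only [Adj] at h
      rcases h with ⟨rfl, rfl | rfl⟩ | ⟨rfl, rfl | rfl⟩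
      · exact cell_const _ hq _ _ ⟨Or.inl rfl, Or.inr rfl⟩
      · exact (cell_const _ hp _ _ ⟨Or.inl rfl, Or.inr rfl⟩).symm
      · exact cell_const _ hq _ _ ⟨Or.inr rfl, Or.inl rfl⟩
      · exact (cell_const _ hp _ _ ⟨Or.inr rfl, Or.inl rfl⟩).symm
    intro p hp q hq x y s t h1 h2
    rw [cell_const p hp x y h1, cell_const q hq s t h2]
    have hpath := hFc p hp q hq
    clear h1 h2 hq
    induction hpath with
    | refl => rfl
    | tail _ h ih => exact ih.trans (adj_const _ h.1 _ h.2.1 h.2.2)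
  · intro x y h
    rw [hv, hf0, hg0]
    · simp
    · tauto
    · by_cases hB : (x, y) ∈ B
      · exact Or.inr fun h => h.2 hB
      · exact Or.inl fun h' => h'.2 (h.2 hB)
  · intro x y h
    rw [hh, hf0, hg0]
    · simp
    · tauto
    · by_cases hB : (x, y) ∈ B
      · exact Or.inr fun h => h.2 hB
      · exact Or.inl fun h' => h'.2 (h.2 hB)

/-- The cells along the outside of the boundary of a box, counterclockwise from the bottom left
corner. -/
def outerCell (a b n t : ℤ) : ℤ × ℤ :=
  if t < n then (a + t, b - 1) else if t < 2 * n then (a + n, b + t - n)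
  else if t < 3 * n then (a + 3 * n - 1 - t, b + n) else (a - 1, b + 4 * n - 1 - t)

/-- The cells along the inside of the boundary of a box. -/
def innerCell (a b n t : ℤ) : ℤ × ℤ :=
  if t < n then (a + t, b) else if t < 2 * n then (a + n - 1, b + t - n)
  else if t < 3 * n then (a + 3 * n - 1 - t, b + n - 1) else (a, b + 4 * n - 1 - t)

/-- The lattice points along the boundary of a box. -/
def rimPoint (a b n t : ℤ) : ℤ × ℤ :=
  if t < n then (a + t, b) else if t < 2 * n then (a + n, b + t - n)
  else if t < 3 * n then (a + 3 * n - t, b + n) else (a, b + 4 * n - t)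

variable {a b n : ℤ}

theorem adj_outerCell_innerCell (t : ℤ) : Adj (outerCell a b n t) (innerCell a b n t) := by
  unfold outerCell innerCell Adj
  split_ifs <;> simp only [true_and] <;> omega

theorem innerCell_mem {t : ℤ} (h0 : 0 ≤ t) (h1 : t < 4 * n) : innerCell a b n t ∈ box a b n := by
  unfold innerCell box
  split_ifs <;> simp only [Set.mem_ofPred_eq] <;> omega

theorem outerCell_notMem (t : ℤ) :
    outerCell a b n t ∉ box a b n := by
  unfold outerCell box
  split_ifs <;> simp only [Set.mem_ofPred_eq] <;> omega

/-- Different rim parameters give different pairs of outer and inner cell, so a unit flow across the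
rim is seen at one parameter only. -/
theorem edgeFlow_rim {t s : ℤ} (ht0 : 0 ≤ t) (ht : t < 4 * n) (hs0 : 0 ≤ s) (hs : s < 4 * n) :
    edgeFlow (outerCell a b n s) (innerCell a b n s) (outerCell a b n t) (innerCell a b n t) =
      if t = s then 1 else 0 := by
  unfold edgeFlow
  congr 1
  rw [eq_iff_iff]
  constructor
  · rintro (⟨h1, h2⟩ | ⟨h1, -⟩)
    · unfold outerCell at h1
      unfold innerCell at h2
      split_ifs at h1 h2 <;> simp only [Prod.mk.injEq] at h1 h2 <;> omega
    · exact absurd (h1 ▸ innerCell_mem hs0 hs) (outerCell_notMem t)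
  · rintro rfl
    simp

theorem edgeFlow_comm (c d p q : ℤ × ℤ) : edgeFlow c d p q = edgeFlow c d q p := by
  unfold edgeFlow
  congr 1
  rw [eq_iff_iff]
  tauto

theorem exists_rim_potential {F : Set (ℤ × ℤ)} (hFc : EdgeConn Fᶜ) (hBF : box a b n ⊆ F)
    {t₁ t₂ : ℤ} (h0 : 0 ≤ t₁) (h12 : t₁ < t₂) (h4 : t₂ < 4 * n)
    (h₁ : outerCell a b n t₁ ∈ F) (h₂ : outerCell a b n t₂ ∈ F)
    (hr : Relation.ReflTransGen (AdjIn (F \ box a b n)) (outerCell a b n t₁)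
      (outerCell a b n t₂)) :
    ∃ w : ℤ → ℤ → ZMod 2,
      (∀ p ∉ F, ∀ q ∉ F, ∀ x y s t, IsCorner p x y → IsCorner q s t → w x y = w s t) ∧
      ∀ t, 0 ≤ t → t < 4 * n → w (rimPoint a b n t).1 (rimPoint a b n t).2 +
        w (rimPoint a b n (t + 1)).1 (rimPoint a b n (t + 1)).2 =
          (if t = t₁ then 1 else 0) + if t = t₂ then 1 else 0 := by
  obtain ⟨w, hw, hv, hh⟩ := exists_boundary_potential hFc (edgeConn_box a b n) hBF hr h₁ h₂
    (innerCell_mem h0 (by omega)) (innerCell_mem (by omega) h4)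
    (adj_outerCell_innerCell t₁) (adj_outerCell_innerCell t₂)
  refine ⟨w, hw, fun t ht0 ht => ?_⟩
  rw [← edgeFlow_rim (a := a) (b := b) ht0 ht h0 (by omega),
    ← edgeFlow_rim (a := a) (b := b) ht0 ht (by omega) h4]
  have hin := innerCell_mem (a := a) (b := b) ht0 ht
  have hout := outerCell_notMem (a := a) (b := b) (n := n) t
  rcases lt_or_ge t n with c1 | c1
  · have e1 : outerCell a b n t = (a + t, b - 1) := by simp [outerCell, c1]
    have e2 : innerCell a b n t = (a + t, b) := by simp [innerCell, c1]
    have e3 : rimPoint a b n t = (a + t, b) := by simp [rimPoint, c1]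
    have e4 : rimPoint a b n (t + 1) = (a + t + 1, b) := by
      unfold rimPoint; split_ifs <;> simp only [Prod.mk.injEq, and_true] <;> omega
    rw [e1] at hout; rw [e2] at hin
    rw [e1, e2, e3, e4]
    exact hh _ _ (by tauto)
  rcases lt_or_ge t (2 * n) with c2 | c2
  · have e1 : outerCell a b n t = (a + n, b + t - n) := by simp [outerCell, c1.not_gt, c2]
    have e2 : innerCell a b n t = (a + n - 1, b + t - n) := by simp [innerCell, c1.not_gt, c2]
    have e3 : rimPoint a b n t = (a + n, b + t - n) := by simp [rimPoint, c1.not_gt, c2]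
    have e4 : rimPoint a b n (t + 1) = (a + n, b + t - n + 1) := by
      unfold rimPoint; split_ifs <;> simp only [Prod.mk.injEq, true_and] <;> omega
    rw [e1] at hout; rw [e2] at hin
    rw [e1, e2, e3, e4, edgeFlow_comm _ _ (a + n, _), edgeFlow_comm _ _ (a + n, _)]
    exact hv _ _ (by tauto)
  -- On the top and left sides the rim runs against the coordinate direction, so the two rim points
  -- trade places in the jump formula.
  rcases lt_or_ge t (3 * n) with c3 | c3
  · have e1 : outerCell a b n t = (a + 3 * n - 1 - t, b + n) := by
      simp [outerCell, c1.not_gt, c2.not_gt, c3]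
    have e2 : innerCell a b n t = (a + 3 * n - 1 - t, b + n - 1) := by
      simp [innerCell, c1.not_gt, c2.not_gt, c3]
    have e3 : rimPoint a b n t = (a + 3 * n - 1 - t + 1, b + n) := by
      simp [rimPoint, c1.not_gt, c2.not_gt, c3]; omega
    have e4 : rimPoint a b n (t + 1) = (a + 3 * n - 1 - t, b + n) := by
      unfold rimPoint; split_ifs <;> simp only [Prod.mk.injEq, and_true] <;> omega
    rw [e1] at hout; rw [e2] at hin
    rw [e1, e2, e3, e4, edgeFlow_comm _ _ (_, b + n), edgeFlow_comm _ _ (_, b + n), add_comm]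
    exact hh _ _ (by tauto)
  · have e1 : outerCell a b n t = (a - 1, b + 4 * n - 1 - t) := by
      simp [outerCell, c1.not_gt, c2.not_gt, c3.not_gt]
    have e2 : innerCell a b n t = (a, b + 4 * n - 1 - t) := by
      simp [innerCell, c1.not_gt, c2.not_gt, c3.not_gt]
    have e3 : rimPoint a b n t = (a, b + 4 * n - 1 - t + 1) := by
      simp [rimPoint, c1.not_gt, c2.not_gt, c3.not_gt]; omega
    have e4 : rimPoint a b n (t + 1) = (a, b + 4 * n - 1 - t) := by
      unfold rimPoint; split_ifs <;> simp only [Prod.mk.injEq, true_and] <;> omega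
    rw [e1] at hout; rw [e2] at hin
    rw [e1, e2, e3, e4, add_comm]
    exact hv _ _ (by tauto)

end

/-! ### How a class of cells touches the box when the convex vertex is the bottom left corner. -/

section

/-- `K` is a class of the cells of `F` outside `B` under edge-connectedness. -/
structure IsClass (F B K : Set (ℤ × ℤ)) : Prop where
  nonempty : K.Nonempty
  sub : K ⊆ F \ B
  closed : ∀ c ∈ K, ∀ d ∈ F \ B, Adj c d → d ∈ K
  conn : ∀ c ∈ K, ∀ d ∈ K, Relation.ReflTransGen (AdjIn (F \ B)) c d

/-- A cell of `K` has the corner `(x, y)`. -/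
def Touches (K : Set (ℤ × ℤ)) (x y : ℤ) : Prop := ∃ c ∈ K, IsCorner c x y

/-- A cell of `K` has an edge on the given side of the box. -/
def TouchesSide (a b n : ℤ) (K : Set (ℤ × ℤ)) : Side → Prop
  | .top => ∃ x, a ≤ x ∧ x < a + n ∧ (x, b + n) ∈ K
  | .bottom => ∃ x, a ≤ x ∧ x < a + n ∧ (x, b - 1) ∈ K
  | .left => ∃ y, b ≤ y ∧ y < b + n ∧ (a - 1, y) ∈ K
  | .right => ∃ y, b ≤ y ∧ y < b + n ∧ (a + n, y) ∈ K

/-- The possible ways in which a class of cells touches a box. -/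
structure RingType (a b n : ℤ) (K : Set (ℤ × ℤ)) : Prop where
  some_side : TouchesSide a b n K .top ∨ TouchesSide a b n K .bottom ∨
    TouchesSide a b n K .left ∨ TouchesSide a b n K .right
  top_bottom : TouchesSide a b n K .top → TouchesSide a b n K .bottom →
    TouchesSide a b n K .left ∨ TouchesSide a b n K .right
  left_right : TouchesSide a b n K .left → TouchesSide a b n K .right →
    TouchesSide a b n K .top ∨ TouchesSide a b n K .bottom
  not_all : TouchesSide a b n K .top → TouchesSide a b n K .bottom →
    TouchesSide a b n K .left → ¬ TouchesSide a b n K .right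
  top_right : TouchesSide a b n K .top → TouchesSide a b n K .right → Touches K (a + n) (b + n)
  top_left : TouchesSide a b n K .top → TouchesSide a b n K .left → Touches K a (b + n)
  bottom_right : TouchesSide a b n K .bottom → TouchesSide a b n K .right → Touches K (a + n) b
  bottom_left : TouchesSide a b n K .bottom → TouchesSide a b n K .left → Touches K a b
  top : Touches K a (b + n) → Touches K (a + n) (b + n) → TouchesSide a b n K .top
  bottom : Touches K a b → Touches K (a + n) b → TouchesSide a b n K .bottom
  left : Touches K a b → Touches K a (b + n) → TouchesSide a b n K .left
  right : Touches K (a + n) b → Touches K (a + n) (b + n) → TouchesSide a b n K .right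

variable {a b n : ℤ} {F K : Set (ℤ × ℤ)}

/-- The potential changes at the rim edge `t₁` and not again up to the rim point `t₂`, so between
them it differs from its value at `(a, b)`. That value is the one at all corners of cells outside
`F`, since `(a - 1, b - 1)` is such a cell. -/
theorem rimPoint_cells_mem (hFc : EdgeConn Fᶜ) (hn : 0 < n) (hBF : box a b n ⊆ F)
    (hv : (a - 1, b - 1) ∉ F) (hK : IsClass F (box a b n) K) {t₁ t₂ : ℤ} (h0 : 0 ≤ t₁)
    (h12 : t₁ < t₂) (h4 : t₂ < 4 * n) (h₁ : outerCell a b n t₁ ∈ K) (h₂ : outerCell a b n t₂ ∈ K)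
    {t : ℤ} (ht₁ : t₁ < t) (ht₂ : t ≤ t₂) {c : ℤ × ℤ}
    (hc : IsCorner c (rimPoint a b n t).1 (rimPoint a b n t).2) : c ∈ F := by
  obtain ⟨w, hw, hjump⟩ := exists_rim_potential hFc hBF h0 h12 h4 (hK.sub h₁).1 (hK.sub h₂).1
    (hK.conn _ h₁ _ h₂)
  have key : ∀ k : ℕ, (k : ℤ) ≤ t₂ → w (rimPoint a b n k).1 (rimPoint a b n k).2 =
      w a b + if t₁ < k then 1 else 0 := by
    intro k
    induction k with
    | zero => intro _; simp [rimPoint, hn, h0.not_gt]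
    | succ k ih =>
      intro hk
      push_cast at hk ⊢
      have e1 := ih (by omega)
      have e2 := hjump k (by omega) (by omega)
      rw [if_neg (show ¬ (k : ℤ) = t₂ by omega)] at e2
      have c1 := CharTwo.add_self_eq_zero (w (rimPoint a b n k).1 (rimPoint a b n k).2)
      have e3 : (if t₁ < (k : ℤ) + 1 then (1 : ZMod 2) else 0) =
          (if t₁ < (k : ℤ) then 1 else 0) + if (k : ℤ) = t₁ then 1 else 0 := by
        split_ifs <;> first | omega | simp
      rw [e3]
      linear_combination e1 + e2 - c1
  by_contra hcF
  have h1 := key t.toNat (by omega)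
  rw [show ((t.toNat : ℕ) : ℤ) = t by omega, if_pos ht₁] at h1
  have h2 := hw c hcF _ hv _ _ a b hc ⟨Or.inr (by simp), Or.inr (by simp)⟩
  rw [h2] at h1
  have : ∀ z : ZMod 2, z ≠ z + 1 := by decide
  exact this _ h1

/-- At the three corners other than the starting one, consecutive outer cells only meet diagonally
and are linked by the cell `d` beyond the corner. -/
theorem outerCell_step (hn : 0 < n) (t : ℤ) :
    Adj (outerCell a b n t) (outerCell a b n (t + 1)) ∨ ∃ d ∉ box a b n,
      IsCorner d (rimPoint a b n (t + 1)).1 (rimPoint a b n (t + 1)).2 ∧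
      Adj (outerCell a b n t) d ∧ Adj d (outerCell a b n (t + 1)) := by
  by_cases h1 : t + 1 = n
  · refine Or.inr ⟨(a + n, b - 1), ?_, ?_, ?_, ?_⟩
    · simp [box]
    all_goals
      simp only [IsCorner, Adj, outerCell, rimPoint]
      split_ifs <;> simp only <;> grind
  by_cases h2 : t + 1 = 2 * n
  · refine Or.inr ⟨(a + n, b + n), ?_, ?_, ?_, ?_⟩
    · simp [box]
    all_goals
      simp only [IsCorner, Adj, outerCell, rimPoint]
      split_ifs <;> simp only <;> grind
  by_cases h3 : t + 1 = 3 * n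
  · refine Or.inr ⟨(a - 1, b + n), ?_, ?_, ?_, ?_⟩
    · simp [box]
    all_goals
      simp only [IsCorner, Adj, outerCell, rimPoint]
      split_ifs <;> simp only <;> grind
  · left
    simp only [Adj, outerCell]
    split_ifs <;> simp only <;> grind

theorem isCorner_outerCell (t : ℤ) :
    IsCorner (outerCell a b n t) (rimPoint a b n t).1 (rimPoint a b n t).2 := by
  simp only [IsCorner, outerCell, rimPoint]
  split_ifs <;> simp only <;> grind

/-- All cells around the rim points in between lie in `F`, so the class spreads from each outer cell
to the next, through the corner cells where necessary. -/
theorem outerCell_mem_of_between (hFc : EdgeConn Fᶜ) (hn : 0 < n) (hBF : box a b n ⊆ F)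
    (hv : (a - 1, b - 1) ∉ F) (hK : IsClass F (box a b n) K) {t₁ t₂ : ℤ} (h0 : 0 ≤ t₁)
    (h4 : t₂ < 4 * n) (h₁ : outerCell a b n t₁ ∈ K) (h₂ : outerCell a b n t₂ ∈ K)
    {t : ℤ} (ht₁ : t₁ ≤ t) (ht₂ : t ≤ t₂) : outerCell a b n t ∈ K := by
  have key : ∀ k : ℕ, t₁ + k ≤ t₂ → outerCell a b n (t₁ + k) ∈ K := by
    intro k
    induction k with
    | zero => intro _; simpa using h₁
    | succ k ih =>
      intro hk
      push_cast at hk ⊢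
      have e1 := ih (by omega)
      have hmem : ∀ c, IsCorner c (rimPoint a b n (t₁ + k + 1)).1
          (rimPoint a b n (t₁ + k + 1)).2 → c ∈ F := fun c hc =>
        rimPoint_cells_mem hFc hn hBF hv hK h0 (by omega) h4 h₁ h₂ (by omega) (by omega) hc
      rw [← add_assoc]
      have hnext : outerCell a b n (t₁ + k + 1) ∈ F \ box a b n :=
        ⟨hmem _ (isCorner_outerCell _), outerCell_notMem _⟩
      rcases outerCell_step (a := a) (b := b) hn (t₁ + k) with
        h | ⟨d, hd, hdc, h1, h2⟩
      · exact hK.closed _ e1 _ hnext h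
      · exact hK.closed _ (hK.closed _ e1 d ⟨hmem d hdc, hd⟩ h1) _ hnext h2
  have := key (t - t₁).toNat (by omega)
  rwa [show t₁ + ((t - t₁).toNat : ℤ) = t by omega] at this

theorem IsClass.exists_adj (hF : EdgeConn F) {B : Set (ℤ × ℤ)} (hBF : B ⊆ F) (hB : B.Nonempty)
    (hK : IsClass F B K) : ∃ c ∈ K, ∃ s ∈ B, Adj c s := by
  obtain ⟨k, hk⟩ := hK.nonempty
  obtain ⟨s, hs⟩ := hB
  have h := hF k (hK.sub hk).1 s (hBF hs)
  by_contra! hno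
  have : ∀ q, Relation.ReflTransGen (AdjIn F) k q → q ∈ K := by
    intro q hq
    induction hq with
    | refl => exact hk
    | tail _ h ih => exact hK.closed _ ih _ ⟨h.2.1, fun hB => hno _ ih _ hB h.2.2⟩ h.2.2
  exact (hK.sub (this s h)).2 hs

theorem touchesSide_bottom_iff : TouchesSide a b n K .bottom ↔
    ∃ t, 0 ≤ t ∧ t < n ∧ outerCell a b n t ∈ K := by
  constructor
  · rintro ⟨x, h1, h2, h⟩
    refine ⟨x - a, by omega, by omega, ?_⟩
    rwa [outerCell, if_pos (by omega), add_sub_cancel]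
  · rintro ⟨t, h1, h2, h⟩
    refine ⟨a + t, by omega, by omega, ?_⟩
    rwa [outerCell, if_pos (by omega)] at h

theorem touchesSide_right_iff : TouchesSide a b n K .right ↔
    ∃ t, n ≤ t ∧ t < 2 * n ∧ outerCell a b n t ∈ K := by
  constructor
  · rintro ⟨y, h1, h2, h⟩
    refine ⟨y - b + n, by omega, by omega, ?_⟩
    rwa [outerCell, if_neg (by omega), if_pos (by omega), show b + (y - b + n) - n = y by ring]
  · rintro ⟨t, h1, h2, h⟩
    refine ⟨b + t - n, by omega, by omega, ?_⟩
    rwa [outerCell, if_neg (by omega), if_pos (by omega)] at h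

theorem touchesSide_top_iff (hn : 0 < n) : TouchesSide a b n K .top ↔
    ∃ t, 2 * n ≤ t ∧ t < 3 * n ∧ outerCell a b n t ∈ K := by
  constructor
  · rintro ⟨x, h1, h2, h⟩
    refine ⟨a + 3 * n - 1 - x, by omega, by omega, ?_⟩
    rwa [outerCell, if_neg (by omega), if_neg (by omega), if_pos (by omega), sub_sub_cancel]
  · rintro ⟨t, h1, h2, h⟩
    refine ⟨a + 3 * n - 1 - t, by omega, by omega, ?_⟩
    rwa [outerCell, if_neg (by omega), if_neg (by omega), if_pos (by omega)] at h

theorem touchesSide_left_iff (hn : 0 < n) : TouchesSide a b n K .left ↔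
    ∃ t, 3 * n ≤ t ∧ t < 4 * n ∧ outerCell a b n t ∈ K := by
  constructor
  · rintro ⟨y, h1, h2, h⟩
    refine ⟨b + 4 * n - 1 - y, by omega, by omega, ?_⟩
    rwa [outerCell, if_neg (by omega), if_neg (by omega), if_neg (by omega), sub_sub_cancel]
  · rintro ⟨t, h1, h2, h⟩
    refine ⟨b + 4 * n - 1 - t, by omega, by omega, ?_⟩
    rwa [outerCell, if_neg (by omega), if_neg (by omega), if_neg (by omega)] at h

/-- A class that touches a corner of the box touches an edge at that corner. -/
theorem IsClass.edge_of_corner (hF : EdgeConn F) (hFc : EdgeConn Fᶜ) {B : Set (ℤ × ℤ)}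
    (hBF : B ⊆ F) (hK : IsClass F B K) {x y s t : ℤ} (hs : s = x + 1 ∨ x = s + 1)
    (ht : t = y + 1 ∨ y = t + 1) (hB : (x, y) ∈ B) (h1 : (s, y) ∉ B) (h2 : (x, t) ∉ B)
    {c : ℤ × ℤ} (hc : c ∈ K) (hcs : c.1 = x ∨ c.1 = s) (hct : c.2 = y ∨ c.2 = t) :
    (s, y) ∈ K ∨ (x, t) ∈ K := by
  obtain ⟨c1, c2⟩ := c
  simp only at hcs hct
  rcases hcs with rfl | rfl <;> rcases hct with rfl | rfl
  · exact absurd hB (hK.sub hc).2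
  · exact Or.inr hc
  · exact Or.inl hc
  · rcases not_pinch hF hFc hs ht (hBF hB) (hK.sub hc).1 with h | h
    · exact Or.inl (hK.closed _ hc _ ⟨h, h1⟩ (by simp only [Adj, true_and]; omega))
    · exact Or.inr (hK.closed _ hc _ ⟨h, h2⟩ (by simp only [Adj, true_and]; omega))

/-- The outer cells of `K` form a contiguous run of parameters in `[0, 4n)`, where `0` is the
vertex. Contact at a corner is first turned into contact along an edge next to it, by
`IsClass.edge_of_corner`. -/
theorem ringType_aux (hF : EdgeConn F) (hFc : EdgeConn Fᶜ) (hn : 0 < n) (hBF : box a b n ⊆ F)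
    (hv : ∀ c ∈ F, IsCorner c a b → c ∈ box a b n) (hmax : ¬ box a b (n + 1) ⊆ F)
    (hK : IsClass F (box a b n) K) : RingType a b n K := by
  have hv0 : (a - 1, b - 1) ∉ F := fun h => by
    have := hv _ h ⟨Or.inr (by simp), Or.inr (by simp)⟩
    simp [box] at this
  have hbetween : ∀ {t₁ t₂ : ℤ} (t : ℤ), 0 ≤ t₁ → t₂ < 4 * n → outerCell a b n t₁ ∈ K →
      outerCell a b n t₂ ∈ K → t₁ ≤ t → t ≤ t₂ → outerCell a b n t ∈ K :=
    fun _ h0 h4 h₁ h₂ => outerCell_mem_of_between hFc hn hBF hv0 hK h0 h4 h₁ h₂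
  -- A run from the bottom to the left covers the right and top sides and the corner beyond `(a + n,
  -- b + n)`, so the box would extend by one row and one column.
  have hbl : TouchesSide a b n K .bottom → ¬ TouchesSide a b n K .left := by
    rw [touchesSide_bottom_iff, touchesSide_left_iff hn]
    rintro ⟨t₁, h1, h2, h3⟩ ⟨t₂, h4, h5, h6⟩
    refine hmax ?_
    rintro ⟨x, y⟩ ⟨⟨hx1, hx2⟩, hy1, hy2⟩
    simp only at hx1 hx2 hy1 hy2
    by_cases hx : x < a + n <;> by_cases hy : y < b + n
    · exact hBF ⟨⟨hx1, hx⟩, hy1, hy⟩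
    · have := hbetween (a + 3 * n - 1 - x) h1 h5 h3 h6 (by omega) (by omega)
      rw [outerCell, if_neg (by omega), if_neg (by omega), if_pos (by omega), sub_sub_cancel,
        show b + n = y by omega] at this
      exact (hK.sub this).1
    · have := hbetween (y - b + n) h1 h5 h3 h6 (by omega) (by omega)
      rw [outerCell, if_neg (by omega), if_pos (by omega), show b + (y - b + n) - n = y by ring,
        show a + n = x by omega] at this
      exact (hK.sub this).1
    · refine rimPoint_cells_mem hFc hn hBF hv0 hK h1 (by omega) h5 h3 h6 (t := 2 * n)
        (by omega) (by omega) ?_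
      rw [rimPoint, if_neg (by omega), if_neg (by omega), if_pos (by omega)]
      simp only [IsCorner]
      omega
  have hnt : ¬ Touches K a b := fun ⟨c, hc, hcc⟩ => (hK.sub hc).2 (hv c (hK.sub hc).1 hcc)
  have oc1 : outerCell a b n n = (a + n, b) := by simp [outerCell, hn]
  have oc2 : outerCell a b n (2 * n) = (a + n - 1, b + n) := by
    simp only [outerCell]; split_ifs <;> grind
  have oc3 : outerCell a b n (3 * n) = (a - 1, b + n - 1) := by
    simp only [outerCell]; split_ifs <;> grind
  have oc1' : outerCell a b n (n - 1) = (a + n - 1, b - 1) := by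
    simp only [outerCell]; split_ifs <;> grind
  have oc2' : outerCell a b n (2 * n - 1) = (a + n, b + n - 1) := by
    simp only [outerCell]; split_ifs <;> grind
  have oc3' : outerCell a b n (3 * n - 1) = (a, b + n) := by
    simp only [outerCell]; split_ifs <;> grind
  have hbr : Touches K (a + n) b → outerCell a b n n ∈ K ∨ outerCell a b n (n - 1) ∈ K := by
    rintro ⟨c, hc, h1, h2⟩
    rw [oc1, oc1']
    exact hK.edge_of_corner hF hFc hBF (x := a + n - 1) (y := b) (s := a + n) (t := b - 1)
      (by omega) (by omega) (by simp only [box, Set.mem_ofPred_eq]; omega)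
      (by simp [box]) (by simp [box]) hc (by omega) (by omega)
  have htr : Touches K (a + n) (b + n) →
      outerCell a b n (2 * n - 1) ∈ K ∨ outerCell a b n (2 * n) ∈ K := by
    rintro ⟨c, hc, h1, h2⟩
    rw [oc2, oc2']
    exact hK.edge_of_corner hF hFc hBF (x := a + n - 1) (y := b + n - 1) (s := a + n) (t := b + n)
      (by omega) (by omega) (by simp only [box, Set.mem_ofPred_eq]; omega)
      (by simp [box]) (by simp [box]) hc (by omega) (by omega)
  have htl : Touches K a (b + n) →
      outerCell a b n (3 * n) ∈ K ∨ outerCell a b n (3 * n - 1) ∈ K := by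
    rintro ⟨c, hc, h1, h2⟩
    rw [oc3, oc3']
    exact hK.edge_of_corner hF hFc hBF (x := a) (y := b + n - 1) (s := a - 1) (t := b + n)
      (by omega) (by omega) (by simp only [box, Set.mem_ofPred_eq]; omega)
      (by simp [box]) (by simp [box]) hc (by omega) (by omega)
  have hB := touchesSide_bottom_iff (a := a) (b := b) (n := n) (K := K)
  have hR := touchesSide_right_iff (a := a) (b := b) (n := n) (K := K)
  have hT := touchesSide_top_iff (a := a) (b := b) (K := K) hn
  have hL := touchesSide_left_iff (a := a) (b := b) (K := K) hn
  constructor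
  · obtain ⟨⟨x, y⟩, hc, ⟨s, t⟩, hs, hadj⟩ := hK.exists_adj hF hBF
      ⟨(a, b), by simp only [box, Set.mem_ofPred_eq]; omega⟩
    have hcB := (hK.sub hc).2
    simp only [box, Set.mem_ofPred_eq, Adj] at hs hcB hadj
    have hcases : (y = b + n ∧ a ≤ x ∧ x < a + n) ∨ (y = b - 1 ∧ a ≤ x ∧ x < a + n) ∨
        (x = a - 1 ∧ b ≤ y ∧ y < b + n) ∨ (x = a + n ∧ b ≤ y ∧ y < b + n) := by omega
    rcases hcases with ⟨rfl, h1, h2⟩ | ⟨rfl, h1, h2⟩ | ⟨rfl, h1, h2⟩ | ⟨rfl, h1, h2⟩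
    · exact Or.inl ⟨x, h1, h2, hc⟩
    · exact Or.inr (Or.inl ⟨x, h1, h2, hc⟩)
    · exact Or.inr (Or.inr (Or.inl ⟨y, h1, h2, hc⟩))
    · exact Or.inr (Or.inr (Or.inr ⟨y, h1, h2, hc⟩))
  · rw [hT, hB, hR]
    rintro ⟨t₂, h4, h5, h6⟩ ⟨t₁, h1, h2, h3⟩
    exact Or.inr ⟨n, le_rfl, by omega, hbetween n h1 (by omega) h3 h6 (by omega) (by omega)⟩
  · rw [hL, hR, hT]
    rintro ⟨t₂, h4, h5, h6⟩ ⟨t₁, h1, h2, h3⟩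
    exact Or.inl ⟨2 * n, le_rfl, by omega,
      hbetween _ (by omega) (by omega) h3 h6 (by omega) (by omega)⟩
  · exact fun _ h1 h2 _ => hbl h1 h2
  · rw [hR, hT]
    rintro ⟨t₂, h4, h5, h6⟩ ⟨t₁, h1, h2, h3⟩
    refine ⟨_, hbetween (2 * n) (by omega) (by omega) h3 h6 (by omega) (by omega), ?_⟩
    rw [oc2]; simp only [IsCorner]; grind
  · rw [hL, hT]
    rintro ⟨t₁, h1, h2, h3⟩ ⟨t₂, h4, h5, h6⟩
    refine ⟨_, hbetween (3 * n) (by omega) (by omega) h3 h6 (by omega) (by omega), ?_⟩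
    rw [oc3]; simp only [IsCorner]; grind
  · rw [hB, hR]
    rintro ⟨t₁, h1, h2, h3⟩ ⟨t₂, h4, h5, h6⟩
    refine ⟨_, hbetween n (by omega) (by omega) h3 h6 (by omega) (by omega), ?_⟩
    rw [oc1]; simp only [IsCorner]; grind
  · exact fun h1 h2 => absurd h2 (hbl h1)
  · intro h1 h2
    rw [hT]
    rcases htl h1 with h1 | h1
    · rcases htr h2 with h2 | h2
      · exact ⟨2 * n, by omega, by omega,
          hbetween _ (by omega) (by omega) h2 h1 (by omega) (by omega)⟩
      · exact ⟨_, by omega, by omega, h2⟩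
    · exact ⟨_, by omega, by omega, h1⟩
  · exact fun h _ => absurd h hnt
  · exact fun h _ => absurd h hnt
  · intro h1 h2
    rw [hR]
    rcases hbr h1 with h1 | h1
    · exact ⟨_, by omega, by omega, h1⟩
    · rcases htr h2 with h2 | h2
      · exact ⟨_, by omega, by omega, h2⟩
      · exact ⟨n, by omega, by omega,
          hbetween _ (by omega) (by omega) h1 h2 (by omega) (by omega)⟩

end

/-! ### Reduction of the four positions of the vertex to one by reflection and transposition. -/

section

variable {a b n : ℤ} {F K : Set (ℤ × ℤ)}

theorem reach_preimage {φ : ℤ × ℤ → ℤ × ℤ} (hφ : ∀ c, φ (φ c) = c)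
    (hadj : ∀ c d, Adj c d → Adj (φ c) (φ d)) {A : Set (ℤ × ℤ)} {c d : ℤ × ℤ}
    (h : Relation.ReflTransGen (AdjIn A) c d) :
    Relation.ReflTransGen (AdjIn (φ ⁻¹' A)) (φ c) (φ d) :=
  Relation.ReflTransGen.lift φ (fun c d h => ⟨by simpa [hφ] using h.1, by simpa [hφ] using h.2.1,
    hadj _ _ h.2.2⟩) _ _ h

theorem EdgeConn.preimage {φ : ℤ × ℤ → ℤ × ℤ} (hφ : ∀ c, φ (φ c) = c)
    (hadj : ∀ c d, Adj c d → Adj (φ c) (φ d)) {A : Set (ℤ × ℤ)} (h : EdgeConn A) :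
    EdgeConn (φ ⁻¹' A) := by
  intro c hc d hd
  simpa [hφ] using reach_preimage hφ hadj (h _ hc _ hd)

theorem IsClass.preimage {φ : ℤ × ℤ → ℤ × ℤ} (hφ : ∀ c, φ (φ c) = c)
    (hadj : ∀ c d, Adj c d → Adj (φ c) (φ d)) {B : Set (ℤ × ℤ)} (h : IsClass F B K) :
    IsClass (φ ⁻¹' F) (φ ⁻¹' B) (φ ⁻¹' K) where
  nonempty := h.nonempty.elim fun c hc => ⟨φ c, by simpa [hφ] using hc⟩
  sub := fun _ hc => h.sub hc
  closed := fun c hc d hd hcd => h.closed _ hc _ hd (hadj _ _ hcd)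
  conn := fun c hc d hd => by
    have := reach_preimage hφ hadj (h.conn _ hc _ hd)
    rwa [hφ, hφ] at this

/-- The reflection of the grid cells in the vertical axis. -/
def reflectCell (c : ℤ × ℤ) : ℤ × ℤ := (-1 - c.1, c.2)

theorem reflectCell_reflectCell (c : ℤ × ℤ) : reflectCell (reflectCell c) = c := by
  simp [reflectCell]

theorem adj_reflectCell (c d : ℤ × ℤ) (h : Adj c d) : Adj (reflectCell c) (reflectCell d) := by
  simp only [Adj, reflectCell] at *; omega

theorem adj_swap (c d : ℤ × ℤ) (h : Adj c d) : Adj c.swap d.swap := by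
  simp only [Adj, Prod.fst_swap, Prod.snd_swap] at *; omega

theorem preimage_reflectCell_box : reflectCell ⁻¹' box a b n = box (-(a + n)) b n := by
  ext c; simp only [box, reflectCell, Set.mem_preimage, Set.mem_ofPred_eq]; omega

theorem preimage_swap_box : Prod.swap ⁻¹' box a b n = box b a n := by
  ext c; simp only [box, Set.mem_preimage, Set.mem_ofPred_eq, Prod.fst_swap, Prod.snd_swap]; omega

theorem isCorner_reflectCell {c : ℤ × ℤ} {x y : ℤ} (h : IsCorner c x y) :
    IsCorner (reflectCell c) (-x) y := by
  simp only [IsCorner, reflectCell] at *; omega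

theorem touches_reflect {x y : ℤ} (h : Touches K x y) :
    Touches (reflectCell ⁻¹' K) (-x) y := by
  obtain ⟨c, hc, h⟩ := h
  exact ⟨reflectCell c, by simpa [reflectCell_reflectCell] using hc, isCorner_reflectCell h⟩

theorem touches_of_reflect {x y : ℤ} (h : Touches (reflectCell ⁻¹' K) x y) :
    Touches K (-x) y := by
  obtain ⟨c, hc, h⟩ := h
  exact ⟨reflectCell c, hc, isCorner_reflectCell h⟩

theorem touches_swap {x y : ℤ} : Touches (Prod.swap ⁻¹' K) x y ↔ Touches K y x := by
  constructor <;> rintro ⟨c, hc, h⟩ <;> exact ⟨c.swap, by simpa using hc, h.2, h.1⟩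

/-- The sides under reflection in the vertical axis. -/
def Side.reflect : Side → Side
  | .left => .right
  | .right => .left
  | d => d

/-- The sides under transposition. -/
def Side.swap : Side → Side
  | .left => .bottom
  | .bottom => .left
  | .right => .top
  | .top => .right

theorem touchesSide_reflect (d : Side) :
    TouchesSide (-(a + n)) b n (reflectCell ⁻¹' K) d.reflect ↔ TouchesSide a b n K d := by
  have e : ∀ x, -1 - (-1 - x) = x := fun x : ℤ => by ring
  cases d <;> simp only [TouchesSide, Side.reflect, reflectCell, Set.mem_preimage]
  · exact ⟨fun ⟨x, h1, h2, h⟩ => ⟨-1 - x, by omega, by omega, h⟩,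
      fun ⟨x, h1, h2, h⟩ => ⟨-1 - x, by omega, by omega, by rwa [e]⟩⟩
  · exact ⟨fun ⟨x, h1, h2, h⟩ => ⟨-1 - x, by omega, by omega, h⟩,
      fun ⟨x, h1, h2, h⟩ => ⟨-1 - x, by omega, by omega, by rwa [e]⟩⟩
  · rw [show -1 - (-(a + n) + n) = a - 1 by ring]
  · rw [show -1 - (-(a + n) - 1) = a + n by ring]

theorem touchesSide_swap (d : Side) :
    TouchesSide b a n (Prod.swap ⁻¹' K) d.swap ↔ TouchesSide a b n K d := by
  cases d <;> simp only [TouchesSide, Side.swap, Set.mem_preimage, Prod.swap_prod_mk]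

theorem RingType.of_reflect (h : RingType (-(a + n)) b n (reflectCell ⁻¹' K)) :
    RingType a b n K := by
  have hT := touchesSide_reflect (a := a) (b := b) (n := n) (K := K) .top
  have hB := touchesSide_reflect (a := a) (b := b) (n := n) (K := K) .bottom
  have hL := touchesSide_reflect (a := a) (b := b) (n := n) (K := K) .left
  have hR := touchesSide_reflect (a := a) (b := b) (n := n) (K := K) .right
  simp only [Side.reflect] at hT hB hL hR
  have t : ∀ x y, Touches (reflectCell ⁻¹' K) x y ↔ Touches K (-x) y := fun x y =>
    ⟨touches_of_reflect, fun h => by simpa using touches_reflect h⟩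
  obtain ⟨h1, h2, h3, h4, h5, h6, h7, h8, h9, h10, h11, h12⟩ := h
  simp only [hT, hB, hL, hR, t] at h1 h2 h3 h4 h5 h6 h7 h8 h9 h10 h11 h12
  rw [show -(-(a + n) + n) = a by ring] at h5 h7 h9 h10 h12
  rw [neg_neg] at h6 h8 h9 h10 h11
  exact ⟨h1.imp_right (Or.imp_right Or.symm), fun t b => (h2 t b).symm, fun l r => h3 r l,
    fun t b l r => h4 t b r l, h6, h5, h8, h7, fun l r => h9 r l, fun l r => h10 r l, h12, h11⟩

theorem RingType.of_swap (h : RingType b a n (Prod.swap ⁻¹' K)) : RingType a b n K := by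
  have hT := touchesSide_swap (a := a) (b := b) (n := n) (K := K) .top
  have hB := touchesSide_swap (a := a) (b := b) (n := n) (K := K) .bottom
  have hL := touchesSide_swap (a := a) (b := b) (n := n) (K := K) .left
  have hR := touchesSide_swap (a := a) (b := b) (n := n) (K := K) .right
  simp only [Side.swap] at hT hB hL hR
  obtain ⟨h1, h2, h3, h4, h5, h6, h7, h8, h9, h10, h11, h12⟩ := h
  simp only [hT, hB, hL, hR, touches_swap] at h1 h2 h3 h4 h5 h6 h7 h8 h9 h10 h11 h12
  exact ⟨by clear * - h1; tauto, fun t b => (h3 b t).symm, fun l r => (h2 r l).symm,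
    fun t b l r => h4 r l b t, fun t r => h5 r t, fun t l => h7 l t, fun b r => h6 r b,
    fun b l => h8 l b, h12, h11, h10, h9⟩

/-- The box `box a b n` fills `F` near its corner `(a + p * n, b + q * n)` and cannot be extended
from this corner within `F`. -/
structure IsMaximalCornerBox (F : Set (ℤ × ℤ)) (a b n p q : ℤ) : Prop where
  conn : EdgeConn F
  conn_compl : EdgeConn Fᶜ
  pos : 0 < n
  sub : box a b n ⊆ F
  corner : ∀ c ∈ F, IsCorner c (a + p * n) (b + q * n) → c ∈ box a b n
  maximal : ¬ box (a - p) (b - q) (n + 1) ⊆ F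

theorem IsMaximalCornerBox.reflect {p q : ℤ} (h : IsMaximalCornerBox F a b n p q) :
    IsMaximalCornerBox (reflectCell ⁻¹' F) (-(a + n)) b n (1 - p) q where
  conn := h.conn.preimage reflectCell_reflectCell adj_reflectCell
  conn_compl := h.conn_compl.preimage reflectCell_reflectCell adj_reflectCell
  pos := h.pos
  sub := by rw [← preimage_reflectCell_box]; exact Set.preimage_mono h.sub
  corner := by
    intro c hc hcc
    rw [← preimage_reflectCell_box]
    refine h.corner _ hc ?_
    have := isCorner_reflectCell hcc
    rwa [show -(-(a + n) + (1 - p) * n) = a + p * n by ring] at this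
  maximal := by
    intro hsub
    refine h.maximal fun c hc => ?_
    have h1 : reflectCell c ∈ box (-(a + n) - (1 - p)) (b - q) (n + 1) := by
      rw [show -(a + n) - (1 - p) = -(a - p + (n + 1)) by ring, ← preimage_reflectCell_box,
        Set.mem_preimage, reflectCell_reflectCell]
      exact hc
    simpa [reflectCell_reflectCell] using hsub h1

theorem IsMaximalCornerBox.swap {p q : ℤ} (h : IsMaximalCornerBox F a b n p q) :
    IsMaximalCornerBox (Prod.swap ⁻¹' F) b a n q p where
  conn := h.conn.preimage Prod.swap_swap adj_swap
  conn_compl := h.conn_compl.preimage Prod.swap_swap adj_swap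
  pos := h.pos
  sub := by rw [← preimage_swap_box]; exact Set.preimage_mono h.sub
  corner := by
    intro c hc hcc
    rw [← preimage_swap_box]
    exact h.corner _ hc ⟨hcc.2, hcc.1⟩
  maximal := by
    intro hsub
    refine h.maximal fun c hc => ?_
    have h1 : c.swap ∈ box (b - q) (a - p) (n + 1) := by
      rw [← preimage_swap_box]
      simpa using hc
    simpa using hsub h1

/-- `p` and `q` encode the corner at which the vertex sits. Reflection replaces `p` by `1 - p` and
transposition exchanges `p` and `q`, so every corner is carried to `(0, 0)`. -/
theorem IsMaximalCornerBox.ringType {p q : ℤ} (hp : p = 0 ∨ p = 1) (hq : q = 0 ∨ q = 1)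
    (h : IsMaximalCornerBox F a b n p q) (hK : IsClass F (box a b n) K) : RingType a b n K := by
  have h00 : ∀ {a b : ℤ} {F K : Set (ℤ × ℤ)}, IsMaximalCornerBox F a b n 0 0 →
      IsClass F (box a b n) K → RingType a b n K := by
    intro a b F K h hK
    refine ringType_aux h.conn h.conn_compl h.pos h.sub (by simpa using h.corner)
      (by simpa using h.maximal) hK
  have h10 : ∀ {a b : ℤ} {F K : Set (ℤ × ℤ)}, IsMaximalCornerBox F a b n 1 0 →
      IsClass F (box a b n) K → RingType a b n K := by
    intro a b F K h hK
    have hK' := hK.preimage reflectCell_reflectCell adj_reflectCell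
    rw [preimage_reflectCell_box] at hK'
    exact (h00 h.reflect hK').of_reflect
  have h01 : ∀ {a b : ℤ} {F K : Set (ℤ × ℤ)}, IsMaximalCornerBox F a b n 0 1 →
      IsClass F (box a b n) K → RingType a b n K := by
    intro a b F K h hK
    have hK' := hK.preimage Prod.swap_swap adj_swap
    rw [preimage_swap_box] at hK'
    exact (h10 h.swap hK').of_swap
  rcases hp with rfl | rfl <;> rcases hq with rfl | rfl
  · exact h00 h hK
  · exact h01 h hK
  · exact h10 h hK
  · have hK' := hK.preimage reflectCell_reflectCell adj_reflectCell
    rw [preimage_reflectCell_box] at hK'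
    exact (h01 h.reflect hK').of_reflect

end

/-! ### Dictionary between planar topology and edge-connectedness of cells. -/

section

open Topology

/-- The union of a set of grid cells. -/
def cells (A : Set (ℤ × ℤ)) : Set (ℝ × ℝ) := ⋃ c ∈ A, cell c

/-- The points all of whose surrounding grid cells belong to `A`. -/
def inner (A : Set (ℤ × ℤ)) : Set (ℝ × ℝ) := {p | ∀ c, p ∈ cell c → c ∈ A}

/-- The open grid cell. -/
def openCell (c : ℤ × ℤ) : Set (ℝ × ℝ) :=
  Set.Ioo (c.1 : ℝ) (c.1 + 1) ×ˢ Set.Ioo (c.2 : ℝ) (c.2 + 1)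

theorem mem_cell {c : ℤ × ℤ} {p : ℝ × ℝ} :
    p ∈ cell c ↔ ((c.1 : ℝ) ≤ p.1 ∧ p.1 ≤ c.1 + 1) ∧ (c.2 : ℝ) ≤ p.2 ∧ p.2 ≤ c.2 + 1 := Iff.rfl

theorem mem_openCell {c : ℤ × ℤ} {p : ℝ × ℝ} :
    p ∈ openCell c ↔ ((c.1 : ℝ) < p.1 ∧ p.1 < c.1 + 1) ∧ (c.2 : ℝ) < p.2 ∧ p.2 < c.2 + 1 :=
  Iff.rfl

theorem mem_cells {A : Set (ℤ × ℤ)} {p : ℝ × ℝ} : p ∈ cells A ↔ ∃ c ∈ A, p ∈ cell c := by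
  simp [cells]

theorem exists_mem_cell (p : ℝ × ℝ) : ∃ c, p ∈ cell c :=
  ⟨(⌊p.1⌋, ⌊p.2⌋), ⟨Int.floor_le _, (Int.lt_floor_add_one _).le⟩,
    Int.floor_le _, (Int.lt_floor_add_one _).le⟩

theorem openCell_subset_cell (c : ℤ × ℤ) : openCell c ⊆ cell c :=
  Set.prod_mono Set.Ioo_subset_Icc_self Set.Ioo_subset_Icc_self

theorem cell_subset_closure_openCell (c : ℤ × ℤ) : cell c ⊆ closure (openCell c) := by
  rw [openCell, closure_prod_eq, closure_Ioo (by simp), closure_Ioo (by simp)]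
  exact subset_rfl

theorem openCell_nonempty (c : ℤ × ℤ) : (openCell c).Nonempty :=
  ⟨(c.1 + 1 / 2, c.2 + 1 / 2), mem_openCell.2 ⟨⟨by simp, by simp; norm_num⟩, by simp,
    by simp; norm_num⟩⟩

theorem eq_of_mem_openCell {c d : ℤ × ℤ} {p : ℝ × ℝ} (hc : p ∈ openCell c) (hd : p ∈ cell d) :
    d = c := by
  rw [mem_openCell] at hc
  rw [mem_cell] at hd
  obtain ⟨⟨h1, h2⟩, h3, h4⟩ := hc
  obtain ⟨⟨h5, h6⟩, h7, h8⟩ := hd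
  have e1 : d.1 < c.1 + 1 := by exact_mod_cast h5.trans_lt h2
  have e2 : c.1 < d.1 + 1 := by exact_mod_cast h1.trans_le h6
  have e3 : d.2 < c.2 + 1 := by exact_mod_cast h7.trans_lt h4
  have e4 : c.2 < d.2 + 1 := by exact_mod_cast h3.trans_le h8
  exact Prod.ext (by omega) (by omega)

theorem isPreconnected_openCell (c : ℤ × ℤ) : IsPreconnected (openCell c) :=
  isPreconnected_Ioo.prod isPreconnected_Ioo

theorem isPreconnected_of_subset_cell {c : ℤ × ℤ} {X : Set (ℝ × ℝ)} (h1 : openCell c ⊆ X)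
    (h2 : X ⊆ cell c) : IsPreconnected X :=
  (isPreconnected_openCell c).subset_closure h1 (h2.trans (cell_subset_closure_openCell c))

/-- The window from `⌈x⌉ - 1` to `⌊x⌋ + 1`, ends excluded, meets only those unit intervals that
contain `x`. -/
theorem eventually_Icc_int (x : ℝ) :
    ∀ᶠ y in 𝓝 x, ∀ k : ℤ, (k : ℝ) ≤ y → y ≤ k + 1 → (k : ℝ) ≤ x ∧ x ≤ k + 1 := by
  have h1 : ((⌈x⌉ - 1 : ℤ) : ℝ) < x := by push_cast; linarith [Int.ceil_lt_add_one x]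
  have h2 : x < ((⌊x⌋ + 1 : ℤ) : ℝ) := by push_cast; exact Int.lt_floor_add_one x
  filter_upwards [Ioo_mem_nhds h1 h2] with y hy k hk1 hk2
  have e1 : k < ⌊x⌋ + 1 := by exact_mod_cast hk1.trans_lt hy.2
  have e2 : ⌈x⌉ - 1 < k + 1 := by exact_mod_cast hy.1.trans_le hk2
  refine ⟨Int.le_floor.1 (by omega), ?_⟩
  have : x ≤ ((k + 1 : ℤ) : ℝ) := Int.ceil_le.1 (by omega)
  exact_mod_cast this

/-- The cells around points near `p` contain `p`. -/
theorem eventually_mem_cell (p : ℝ × ℝ) : ∀ᶠ q in 𝓝 p, ∀ c, q ∈ cell c → p ∈ cell c := by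
  have h1 := (continuous_fst.tendsto p).eventually (eventually_Icc_int p.1)
  have h2 := (continuous_snd.tendsto p).eventually (eventually_Icc_int p.2)
  filter_upwards [h1, h2] with q hq1 hq2 c hc
  exact ⟨hq1 c.1 hc.1.1 hc.1.2, hq2 c.2 hc.2.1 hc.2.2⟩

theorem isOpen_inner (A : Set (ℤ × ℤ)) : IsOpen (inner A) := by
  rw [isOpen_iff_mem_nhds]
  intro p hp
  filter_upwards [eventually_mem_cell p] with q hq c hc
  exact hp c (hq c hc)

theorem compl_cells (A : Set (ℤ × ℤ)) : (cells A)ᶜ = inner Aᶜ := by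
  ext p
  rw [Set.mem_compl_iff, mem_cells]
  exact ⟨fun h c hc hA => h ⟨c, hA, hc⟩, fun h ⟨c, hA, hc⟩ => h c hc hA⟩

theorem isClosed_cells (A : Set (ℤ × ℤ)) : IsClosed (cells A) := by
  rw [← isOpen_compl_iff, compl_cells]
  exact isOpen_inner _

theorem cell_subset_cells {A : Set (ℤ × ℤ)} {c : ℤ × ℤ} (h : c ∈ A) : cell c ⊆ cells A :=
  Set.subset_biUnion_of_mem (u := cell) h

theorem mem_of_openCell_inter {A : Set (ℤ × ℤ)} {c : ℤ × ℤ} {p : ℝ × ℝ} (hc : p ∈ openCell c)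
    (hA : p ∈ cells A) : c ∈ A := by
  obtain ⟨d, hd, hpd⟩ := mem_cells.1 hA
  rwa [← eq_of_mem_openCell hc hpd]

theorem inner_subset_cells (A : Set (ℤ × ℤ)) : inner A ⊆ cells A := by
  intro p hp
  obtain ⟨c, hc⟩ := exists_mem_cell p
  exact mem_cells.2 ⟨c, hp c hc, hc⟩

theorem interior_cells (A : Set (ℤ × ℤ)) : interior (cells A) = inner A := by
  refine subset_antisymm (fun p hp c hc => ?_)
    (interior_maximal (inner_subset_cells A) (isOpen_inner A))
  obtain ⟨q, hq1, hq2⟩ := mem_closure_iff.1 (cell_subset_closure_openCell c hc) _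
    isOpen_interior hp
  exact mem_of_openCell_inter hq2 (interior_subset hq1)

theorem openCell_subset_inner {A : Set (ℤ × ℤ)} {c : ℤ × ℤ} (h : c ∈ A) :
    openCell c ⊆ inner A := fun _ hp _ hd => eq_of_mem_openCell hp hd ▸ h

theorem mem_cell_mix {c d : ℤ × ℤ} {p : ℝ × ℝ} (hc : p ∈ cell c) (hd : p ∈ cell d) :
    p ∈ cell (c.1, d.2) := ⟨hc.1, hd.2⟩

theorem near_of_mem_cell {c d : ℤ × ℤ} {p : ℝ × ℝ} (hc : p ∈ cell c) (hd : p ∈ cell d) :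
    (c.1 = d.1 ∨ c.1 = d.1 + 1 ∨ d.1 = c.1 + 1) ∧
      (c.2 = d.2 ∨ c.2 = d.2 + 1 ∨ d.2 = c.2 + 1) := by
  obtain ⟨⟨h1, h2⟩, h3, h4⟩ := mem_cell.1 hc
  obtain ⟨⟨h5, h6⟩, h7, h8⟩ := mem_cell.1 hd
  have e1 : d.1 ≤ c.1 + 1 := by exact_mod_cast h5.trans h2
  have e2 : c.1 ≤ d.1 + 1 := by exact_mod_cast h1.trans h6
  have e3 : d.2 ≤ c.2 + 1 := by exact_mod_cast h7.trans h4
  have e4 : c.2 ≤ d.2 + 1 := by exact_mod_cast h3.trans h8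
  omega

theorem reach_of_eq_or_adj {A : Set (ℤ × ℤ)} {c d : ℤ × ℤ} (hc : c ∈ A) (hd : d ∈ A)
    (h : c = d ∨ Adj c d) : Relation.ReflTransGen (AdjIn A) c d := by
  rcases h with rfl | h
  · exact .refl
  · exact .single ⟨hc, hd, h⟩

/-- Two cells that share a point are connected if a cell in the row of the one and the column of
the other is available. -/
theorem reach_of_mix {A : Set (ℤ × ℤ)} {c d : ℤ × ℤ} {p : ℝ × ℝ} (hpc : p ∈ cell c)
    (hpd : p ∈ cell d) (hc : c ∈ A) (hd : d ∈ A) (h : (c.1, d.2) ∈ A) :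
    Relation.ReflTransGen (AdjIn A) c d := by
  obtain ⟨h1, h2⟩ := near_of_mem_cell hpc hpd
  refine (reach_of_eq_or_adj hc h ?_).trans (reach_of_eq_or_adj h hd ?_)
  · rcases h2 with h2 | h2
    · exact Or.inl (Prod.ext rfl h2)
    · exact Or.inr (Or.inl ⟨rfl, h2⟩)
  · rcases h1 with h1 | h1
    · exact Or.inl (Prod.ext h1 rfl)
    · exact Or.inr (Or.inr ⟨rfl, h1⟩)

theorem exists_mem_cell_iff_of_adj {c d : ℤ × ℤ} (h : Adj c d) :
    ∃ m : ℝ × ℝ, ∀ e, m ∈ cell e ↔ e = c ∨ e = d := by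
  have horiz : ∀ x y : ℤ, ∃ m : ℝ × ℝ, ∀ e, m ∈ cell e ↔ e = (x, y) ∨ e = (x + 1, y) := by
    intro x y
    refine ⟨(x + 1, y + 1 / 2), fun e => ?_⟩
    rw [mem_cell]
    constructor
    · rintro ⟨⟨h1, h2⟩, h3, h4⟩
      simp only at h1 h2 h3 h4
      have e1 : e.1 ≤ x + 1 := by exact_mod_cast h1
      have e2 : x ≤ e.1 := by exact_mod_cast (by linarith : (x : ℝ) ≤ e.1)
      have e3 : e.2 < y + 1 := by exact_mod_cast (by linarith : (e.2 : ℝ) < y + 1)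
      have e4 : y < e.2 + 1 := by exact_mod_cast (by linarith : (y : ℝ) < e.2 + 1)
      rcases (by omega : e.1 = x ∨ e.1 = x + 1) with h | h
      · exact Or.inl (Prod.ext h (by simp only; omega))
      · exact Or.inr (Prod.ext h (by simp only; omega))
    · rintro (rfl | rfl) <;> push_cast <;> refine ⟨⟨?_, ?_⟩, ?_, ?_⟩ <;> linarith
  have vert : ∀ x y : ℤ, ∃ m : ℝ × ℝ, ∀ e, m ∈ cell e ↔ e = (x, y) ∨ e = (x, y + 1) := by
    intro x y
    obtain ⟨m, hm⟩ := horiz y x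
    refine ⟨m.swap, fun e => ?_⟩
    have : m.swap ∈ cell e ↔ m ∈ cell e.swap := ⟨fun h => ⟨h.2, h.1⟩, fun h => ⟨h.2, h.1⟩⟩
    rw [this, hm]
    obtain ⟨e1, e2⟩ := e
    simp [and_comm]
  obtain ⟨c1, c2⟩ := c
  obtain ⟨d1, d2⟩ := d
  simp only [Adj] at h
  rcases h with ⟨rfl, rfl | rfl⟩ | ⟨rfl, rfl | rfl⟩
  · obtain ⟨m, hm⟩ := vert c1 d2
    exact ⟨m, fun e => by rw [hm, or_comm]⟩
  · exact vert _ _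
  · obtain ⟨m, hm⟩ := horiz d1 c2
    exact ⟨m, fun e => by rw [hm, or_comm]⟩
  · exact horiz _ _

/-- All cells around a point of `inner A` lie in `A`, and any two of them are joined through the
cell with the column of one and the row of the other. A reachability class and the rest of `A` would
thus split `inner A` into disjoint open sets. -/
theorem edgeConn_of_isPreconnected {A : Set (ℤ × ℤ)} (h : IsPreconnected (inner A)) :
    EdgeConn A := by
  intro c hc d hd
  by_contra hcd
  set B : Set (ℤ × ℤ) := {e | Relation.ReflTransGen (AdjIn A) c e} with hB
  obtain ⟨p, hp⟩ := openCell_nonempty c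
  obtain ⟨q, hq⟩ := openCell_nonempty d
  have hsub : inner A ⊆ inner (A ∩ B) ∪ inner (A \ B) := by
    intro z hz
    obtain ⟨e, he⟩ := exists_mem_cell z
    have hreach : ∀ e', z ∈ cell e' → Relation.ReflTransGen (AdjIn A) e e' := fun e' he' =>
      reach_of_mix he he' (hz _ he) (hz _ he') (hz _ (mem_cell_mix he he'))
    by_cases heB : e ∈ B
    · exact Or.inl fun e' he' => ⟨hz _ he', Relation.ReflTransGen.trans heB (hreach e' he')⟩
    · exact Or.inr fun e' he' => ⟨hz _ he', fun hB' =>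
        heB (Relation.ReflTransGen.trans hB' (reach_symm (hreach e' he')))⟩
  have hcB : c ∈ A ∩ B := ⟨hc, Relation.ReflTransGen.refl⟩
  have hdB : d ∈ A \ B := ⟨hd, hcd⟩
  obtain ⟨z, -, hz1, hz2⟩ := h _ _ (isOpen_inner _) (isOpen_inner _) hsub
    ⟨p, openCell_subset_inner hc hp, openCell_subset_inner hcB hp⟩
    ⟨q, openCell_subset_inner hd hq, openCell_subset_inner hdB hq⟩
  obtain ⟨e, he⟩ := exists_mem_cell z
  exact (hz2 e he).2 (hz1 e he).2

/-- The part of `inner A` in a cell lies between the open cell and its closure, and the parts in two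
adjacent cells share a point of the common edge. -/
theorem isConnected_inner {A : Set (ℤ × ℤ)} (h : EdgeConn A) (hne : A.Nonempty) :
    IsConnected (inner A) := by
  obtain ⟨c, hc⟩ := hne
  refine ⟨(openCell_nonempty c).mono (openCell_subset_inner hc), ?_⟩
  have e : inner A = ⋃ c ∈ A, (inner A ∩ cell c) := by
    rw [← Set.inter_iUnion₂]
    exact (Set.inter_eq_left.2 (inner_subset_cells A)).symm
  rw [e]
  refine IsPreconnected.biUnion_of_reflTransGen (fun c hc => isPreconnected_of_subset_cell
    (Set.subset_inter (openCell_subset_inner hc) (openCell_subset_cell c))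
    Set.inter_subset_right) fun c hc d hd => ?_
  refine Relation.ReflTransGen.mono ?_ _ _ (h c hc d hd)
  rintro c d ⟨hc, hd, hcd⟩
  obtain ⟨m, hm⟩ := exists_mem_cell_iff_of_adj hcd
  have hmA : m ∈ inner A := fun e he => by rcases (hm e).1 he with rfl | rfl <;> assumption
  exact ⟨⟨m, ⟨hmA, (hm c).2 (Or.inl rfl)⟩, hmA, (hm d).2 (Or.inr rfl)⟩, hc⟩

/-- The combinatorial description of orthogonal polygons. -/
theorem isOrthogonalPolygon_cells {A : Set (ℤ × ℤ)} (hfin : A.Finite) (hne : A.Nonempty)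
    (h : EdgeConn A) (hc : EdgeConn Aᶜ) : IsOrthogonalPolygon (cells A) := by
  refine ⟨⟨hfin.toFinset, by simp [cells]⟩, ?_, ?_⟩
  · rw [interior_cells]
    exact isConnected_inner h hne
  · rw [compl_cells]
    exact isConnected_inner hc hfin.infinite_compl.nonempty

theorem IsOrthogonalPolygon.exists_cells {P : Set (ℝ × ℝ)} (hP : IsOrthogonalPolygon P) :
    ∃ A : Set (ℤ × ℤ), A.Finite ∧ P = cells A ∧ EdgeConn A ∧ EdgeConn Aᶜ := by
  obtain ⟨⟨A, rfl⟩, h1, h2⟩ := hP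
  refine ⟨A, A.finite_toSet, rfl, ?_, ?_⟩
  · have := h1.isPreconnected
    change IsPreconnected (interior (cells A)) at this
    rw [interior_cells] at this
    exact edgeConn_of_isPreconnected this
  · have := h2.isPreconnected
    change IsPreconnected (cells A)ᶜ at this
    rw [compl_cells] at this
    exact edgeConn_of_isPreconnected this

variable {F B : Set (ℤ × ℤ)}

theorem isPreconnected_cell_diff {c : ℤ × ℤ} (hc : c ∉ B) : IsPreconnected (cell c \ cells B) :=
  isPreconnected_of_subset_cell (fun _ hp => ⟨openCell_subset_cell c hp, fun h =>
    hc (mem_of_openCell_inter hp h)⟩) Set.sdiff_subset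

theorem exists_of_mem_diff {p : ℝ × ℝ} (hp : p ∈ cells F \ cells B) :
    ∃ c ∈ F \ B, p ∈ cell c \ cells B := by
  obtain ⟨c, hc, hpc⟩ := mem_cells.1 hp.1
  exact ⟨c, ⟨hc, fun h => hp.2 (cell_subset_cells h hpc)⟩, hpc, hp.2⟩

theorem cell_diff_subset {c : ℤ × ℤ} (hc : c ∈ F \ B) : cell c \ cells B ⊆ cells F \ cells B :=
  Set.sdiff_subset_sdiff_left (cell_subset_cells hc.1)

theorem cell_diff_subset_component {c : ℤ × ℤ} (hc : c ∈ F \ B) {p q : ℝ × ℝ}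
    (hq : q ∈ cell c \ cells B) (hqp : q ∈ connectedComponentIn (cells F \ cells B) p) :
    cell c \ cells B ⊆ connectedComponentIn (cells F \ cells B) p := by
  rw [connectedComponentIn_eq hqp]
  exact (isPreconnected_cell_diff hc.2).subset_connectedComponentIn hq (cell_diff_subset hc)

theorem exists_mem_both_of_adj {c d : ℤ × ℤ} (hc : c ∉ B) (hd : d ∉ B) (h : Adj c d) :
    ∃ m, m ∈ cell c \ cells B ∧ m ∈ cell d \ cells B := by
  obtain ⟨m, hm⟩ := exists_mem_cell_iff_of_adj h
  have hmB : m ∉ cells B := by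
    rw [mem_cells]
    rintro ⟨e, he, hme⟩
    rcases (hm e).1 hme with rfl | rfl
    · exact hc he
    · exact hd he
  exact ⟨m, ⟨(hm c).2 (Or.inl rfl), hmB⟩, (hm d).2 (Or.inr rfl), hmB⟩

/-- Without pinches, cells that share a point outside `B` are edge-connected outside `B`. -/
theorem reach_of_common_point (hF : EdgeConn F) (hFc : EdgeConn Fᶜ) {c d : ℤ × ℤ} {p : ℝ × ℝ}
    (hc : c ∈ F) (hd : d ∈ F) (hpc : p ∈ cell c) (hpd : p ∈ cell d) (hp : p ∉ cells B) :
    Relation.ReflTransGen (AdjIn (F \ B)) c d := by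
  have hB : ∀ e, p ∈ cell e → e ∉ B := fun e he h => hp (cell_subset_cells h he)
  have hcB := hB c hpc
  have hdB := hB d hpd
  have h1 := hB _ (mem_cell_mix hpc hpd)
  have h2 := hB _ (mem_cell_mix hpd hpc)
  -- Cells in the same row or column cause no problem; for diagonal ones the absence of pinches
  -- supplies a third cell.
  have key : (c.1, d.2) ∈ F ∨ (d.1, c.2) ∈ F := by
    obtain ⟨hx, hy⟩ := near_of_mem_cell hpc hpd
    rcases hx with hx | hx
    · left; rw [hx]; exact hd
    rcases hy with hy | hy
    · left; rw [← hy]; exact hc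
    exact (not_pinch hF hFc (x := c.1) (s := d.1) (y := c.2) (t := d.2) hx.symm hy.symm
      hc hd).symm
  rcases key with h | h
  · exact reach_of_mix hpc hpd ⟨hc, hcB⟩ ⟨hd, hdB⟩ ⟨h, h1⟩
  · exact reach_symm (reach_of_mix hpd hpc ⟨hd, hdB⟩ ⟨hc, hcB⟩ ⟨h, h2⟩)

/-- The components of the region outside `B` are the edge-connected classes of cells. -/
theorem exists_isClass (hF : EdgeConn F) (hFc : EdgeConn Fᶜ) {p : ℝ × ℝ}
    (hp : p ∈ cells F \ cells B) : ∃ K, IsClass F B K ∧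
      connectedComponentIn (cells F \ cells B) p = cells K \ cells B := by
  obtain ⟨c, hc, hpc⟩ := exists_of_mem_diff hp
  set K : Set (ℤ × ℤ) := {d | Relation.ReflTransGen (AdjIn (F \ B)) c d} with hKdef
  have hKsub : K ⊆ F \ B := by
    intro d hd
    rcases Relation.ReflTransGen.cases_tail hd with rfl | ⟨e, -, h⟩
    · exact hc
    · exact h.2.1
  have hK : IsClass F B K :=
    ⟨⟨c, Relation.ReflTransGen.refl⟩, hKsub, fun d hd e he hde =>
      Relation.ReflTransGen.tail hd ⟨hKsub hd, he, hde⟩, fun d hd e he =>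
      (reach_symm hd).trans he⟩
  refine ⟨K, hK, subset_antisymm ?_ ?_⟩
  · intro q hq
    have hqX := connectedComponentIn_subset _ _ hq
    refine ⟨?_, hqX.2⟩
    by_contra hqK
    obtain ⟨d, hd, hqd⟩ := exists_of_mem_diff hqX
    -- Two closed sets cover the component. A common point would join a cell of `K` to a cell
    -- outside `K`, by `reach_of_common_point`, so connectedness keeps the component in the first
    -- set.
    have hsub : connectedComponentIn (cells F \ cells B) p ⊆ cells K ∪ cells ((F \ B) \ K) := by
      intro z hz
      obtain ⟨e, he, hze⟩ := exists_of_mem_diff (connectedComponentIn_subset _ _ hz)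
      by_cases heK : e ∈ K
      · exact Or.inl (cell_subset_cells heK hze.1)
      · exact Or.inr (cell_subset_cells (show e ∈ (F \ B) \ K from ⟨he, heK⟩) hze.1)
    obtain ⟨z, hz, hz1, hz2⟩ := isPreconnected_closed_iff.1
      (isPreconnected_connectedComponentIn (x := p) (F := cells F \ cells B)) _ _
      (isClosed_cells K) (isClosed_cells _) hsub
      ⟨p, mem_connectedComponentIn hp, cell_subset_cells Relation.ReflTransGen.refl hpc.1⟩
      ⟨q, hq, (hsub hq).resolve_left hqK⟩
    obtain ⟨e, he, hze⟩ := mem_cells.1 hz1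
    obtain ⟨e', he', hze'⟩ := mem_cells.1 hz2
    exact he'.2 (Relation.ReflTransGen.trans he (reach_of_common_point hF hFc (hKsub he).1
      he'.1.1 hze hze' (connectedComponentIn_subset _ _ hz).2))
  · have key : ∀ d, Relation.ReflTransGen (AdjIn (F \ B)) c d →
        cell d \ cells B ⊆ connectedComponentIn (cells F \ cells B) p := by
      intro d hd
      induction hd with
      | refl => exact cell_diff_subset_component hc hpc (mem_connectedComponentIn hp)
      | tail _ h ih =>
        obtain ⟨m, hm1, hm2⟩ := exists_mem_both_of_adj h.1.2 h.2.1.2 h.2.2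
        exact cell_diff_subset_component h.2.1 hm2 (ih hm1)
    rintro q ⟨hq, hqB⟩
    obtain ⟨d, hd, hqd⟩ := mem_cells.1 hq
    exact key d hd ⟨hqd, hqB⟩

theorem closure_cells_diff {K : Set (ℤ × ℤ)} (hK : K ⊆ Bᶜ) :
    closure (cells K \ cells B) = cells K := by
  refine subset_antisymm (closure_minimal Set.sdiff_subset (isClosed_cells K)) fun p hp => ?_
  obtain ⟨c, hc, hpc⟩ := mem_cells.1 hp
  refine closure_mono ?_ (cell_subset_closure_openCell c hpc)
  exact fun q hq => ⟨cell_subset_cells hc (openCell_subset_cell c hq), fun h =>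
    hK hc (mem_of_openCell_inter hq h)⟩

end

/-! ### Unions of the box with components are polygons, and every component has a type. -/

section

open Topology

variable {F B G : Set (ℤ × ℤ)} {a b n : ℤ}

/-- A path in `F` from `G` to `B` cannot leave `G` before it enters `B`. -/
theorem edgeConn_union (hF : EdgeConn F) (hB : EdgeConn B) (hBF : B ⊆ F) (hne : B.Nonempty)
    (hG : G ⊆ F \ B) (hclosed : ∀ c ∈ G, ∀ d ∈ F \ B, Adj c d → d ∈ G) : EdgeConn (B ∪ G) := by
  obtain ⟨s, hs⟩ := hne
  have key : ∀ g ∈ G, Relation.ReflTransGen (AdjIn (B ∪ G)) g s := by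
    intro g hg
    have hpath : ∀ q, Relation.ReflTransGen (AdjIn F) g q →
        (∃ s' ∈ B, Relation.ReflTransGen (AdjIn (B ∪ G)) g s') ∨
          (q ∈ G ∧ Relation.ReflTransGen (AdjIn (B ∪ G)) g q) := by
      intro q hq
      induction hq with
      | refl => exact Or.inr ⟨hg, .refl⟩
      | @tail q r _ h ih =>
        rcases ih with ih | ⟨hq, ih⟩
        · exact Or.inl ih
        · by_cases hr : r ∈ B
          · exact Or.inl ⟨r, hr, ih.tail ⟨Or.inr hq, Or.inl hr, h.2.2⟩⟩
          · have := hclosed q hq r ⟨h.2.1, hr⟩ h.2.2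
            exact Or.inr ⟨this, ih.tail ⟨Or.inr hq, Or.inr this, h.2.2⟩⟩
    rcases hpath s (hF g (hG hg).1 s (hBF hs)) with ⟨s', hs', h⟩ | ⟨h, -⟩
    · exact h.trans (reach_mono Set.subset_union_left (hB s' hs' s hs))
    · exact absurd hs (hG h).2
  have key' : ∀ g ∈ B ∪ G, Relation.ReflTransGen (AdjIn (B ∪ G)) g s := by
    rintro g (hg | hg)
    · exact reach_mono Set.subset_union_left (hB g hg s hs)
    · exact key g hg
  exact fun c hc d hd => (key' c hc).trans (reach_symm (key' d hd))

/-- A walk that avoids `B` cannot pass into `G` while it stays in `F`, because `G` is closed under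
adjacency in `F \ B`. So it leaves `F` before meeting `G`. -/
theorem exists_reach_compl (hBF : B ⊆ F) (hG : G ⊆ F \ B)
    (hclosed : ∀ c ∈ G, ∀ d ∈ F \ B, Adj c d → d ∈ G) (r : ℕ → ℤ × ℤ)
    (hadj : ∀ k, Adj (r k) (r (k + 1))) (hrB : ∀ k, r k ∉ B) (hrF : ∃ k, r k ∉ F)
    (h0 : r 0 ∉ G) : ∃ e ∉ F, Relation.ReflTransGen (AdjIn (B ∪ G)ᶜ) (r 0) e := by
  have hsub : Fᶜ ⊆ (B ∪ G)ᶜ := Set.compl_subset_compl.2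
    (Set.union_subset hBF fun c hc => (hG hc).1)
  have hstep : ∀ k, (∃ e ∉ F, Relation.ReflTransGen (AdjIn (B ∪ G)ᶜ) (r 0) e) ∨
      (r k ∈ F ∧ r k ∉ G ∧ Relation.ReflTransGen (AdjIn (B ∪ G)ᶜ) (r 0) (r k)) := by
    intro k
    induction k with
    | zero =>
      by_cases h : r 0 ∈ F
      · exact Or.inr ⟨h, h0, .refl⟩
      · exact Or.inl ⟨_, h, .refl⟩
    | succ k ih =>
      rcases ih with ih | ⟨h1, h2, h3⟩
      · exact Or.inl ih
      · have hk : r k ∈ (B ∪ G)ᶜ := fun h => h.elim (hrB k) h2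
        by_cases h : r (k + 1) ∈ F
        · have hn : r (k + 1) ∉ G := fun hg => h2 (hclosed _ hg _ ⟨h1, hrB k⟩ (hadj k).symm)
          exact Or.inr ⟨h, hn, h3.tail ⟨hk, fun h => h.elim (hrB _) hn, hadj k⟩⟩
        · exact Or.inl ⟨_, h, h3.tail ⟨hk, hsub h, hadj k⟩⟩
  obtain ⟨k, hk⟩ := hrF
  exact (hstep k).resolve_right fun h => hk h.1

/-- From a cell off the box, one of the four axis directions gives a ray that misses the box, and
finiteness of `F` forces this ray out of `F`. The cells reached are joined inside `Fᶜ`. -/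
theorem edgeConn_compl_union (hFfin : F.Finite) (hFc : EdgeConn Fᶜ) (hBF : box a b n ⊆ F)
    (hG : G ⊆ F \ box a b n)
    (hclosed : ∀ c ∈ G, ∀ d ∈ F \ box a b n, Adj c d → d ∈ G) :
    EdgeConn (box a b n ∪ G)ᶜ := by
  have hsub : Fᶜ ⊆ (box a b n ∪ G)ᶜ := Set.compl_subset_compl.2
    (Set.union_subset hBF fun c hc => (hG hc).1)
  have key : ∀ c ∈ (box a b n ∪ G)ᶜ,
      ∃ e ∉ F, Relation.ReflTransGen (AdjIn (box a b n ∪ G)ᶜ) c e := by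
    rintro ⟨x, y⟩ hc
    have hcB : (x, y) ∉ box a b n := fun h => hc (Or.inl h)
    have hcG : (x, y) ∉ G := fun h => hc (Or.inr h)
    have hleave : ∀ r : ℕ → ℤ × ℤ, Function.Injective r → ∃ k, r k ∉ F := by
      intro r hr
      by_contra! h
      exact Set.infinite_range_of_injective hr (hFfin.subset (Set.range_subset_iff.2 h))
    have hcases : a + n ≤ x ∨ x < a ∨ b + n ≤ y ∨ y < b := by
      simp only [box, Set.mem_ofPred_eq] at hcB; omega
    rcases hcases with h | h | h | h
    · have := exists_reach_compl hBF hG hclosed (fun k : ℕ => (x + k, y))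
        (fun k => by simp only [Adj, true_and]; push_cast; omega)
        (fun k => by simp only [box, Set.mem_ofPred_eq]; omega)
        (hleave _ fun i j hij => by simpa using hij) (by simpa using hcG)
      simpa using this
    · have := exists_reach_compl hBF hG hclosed (fun k : ℕ => (x - k, y))
        (fun k => by simp only [Adj, true_and]; push_cast; omega)
        (fun k => by simp only [box, Set.mem_ofPred_eq]; omega)
        (hleave _ fun i j hij => by simpa using hij) (by simpa using hcG)
      simpa using this
    · have := exists_reach_compl hBF hG hclosed (fun k : ℕ => (x, y + k))
        (fun k => by simp only [Adj, true_and]; push_cast; omega)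
        (fun k => by simp only [box, Set.mem_ofPred_eq]; omega)
        (hleave _ fun i j hij => by simpa using hij) (by simpa using hcG)
      simpa using this
    · have := exists_reach_compl hBF hG hclosed (fun k : ℕ => (x, y - k))
        (fun k => by simp only [Adj, true_and]; push_cast; omega)
        (fun k => by simp only [box, Set.mem_ofPred_eq]; omega)
        (hleave _ fun i j hij => by simpa using hij) (by simpa using hcG)
      simpa using this
  intro c hc d hd
  obtain ⟨e, he, hce⟩ := key c hc
  obtain ⟨e', he', hde⟩ := key d hd
  exact (hce.trans (reach_mono hsub (hFc e he e' he'))).trans (reach_symm hde)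

theorem exists_int_Icc {x : ℝ} (hn : 0 < n) (h1 : (a : ℝ) ≤ x) (h2 : x ≤ a + n) :
    ∃ k : ℤ, (a ≤ k ∧ k < a + n) ∧ (k : ℝ) ≤ x ∧ x ≤ k + 1 := by
  by_cases h : x < a + n
  · have e2 : (⌊x⌋ : ℝ) < ((a + n : ℤ) : ℝ) := by push_cast; exact (Int.floor_le x).trans_lt h
    exact ⟨⌊x⌋, ⟨Int.le_floor.2 h1, by exact_mod_cast e2⟩, Int.floor_le x,
      (Int.lt_floor_add_one x).le⟩
  -- At the far end the floor would name the interval just beyond the box, so the last one inside is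
  -- taken.
  · have e : x = a + n := le_antisymm h2 (not_lt.1 h)
    exact ⟨a + n - 1, ⟨by omega, by omega⟩, by push_cast; linarith, by push_cast; linarith⟩

theorem Square.region_eq_cells {S : Square} (hn : 0 < n) (hx : S.x = a) (hy : S.y = b)
    (hl : S.len = n) : S.region = cells (box a b n) := by
  ext p
  rw [mem_cells]
  simp only [Square.region, Set.mem_prod, Set.mem_Icc, hx, hy, hl]
  constructor
  · rintro ⟨⟨h1, h2⟩, h3, h4⟩
    obtain ⟨k, hk, hk'⟩ := exists_int_Icc hn h1 h2
    obtain ⟨l, hl, hl'⟩ := exists_int_Icc hn h3 h4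
    exact ⟨(k, l), ⟨hk, hl⟩, hk', hl'⟩
  · rintro ⟨c, ⟨⟨h1, h2⟩, h3, h4⟩, ⟨h5, h6⟩, h7, h8⟩
    have e1 : (a : ℝ) ≤ c.1 := by exact_mod_cast h1
    have e2 : (c.1 : ℝ) + 1 ≤ a + n := by exact_mod_cast h2
    have e3 : (b : ℝ) ≤ c.2 := by exact_mod_cast h3
    have e4 : (c.2 : ℝ) + 1 ≤ b + n := by exact_mod_cast h4
    exact ⟨⟨by linarith, by linarith⟩, by linarith, by linarith⟩

theorem lattice_mem_cell {c : ℤ × ℤ} {x y : ℤ} : ((x : ℝ), (y : ℝ)) ∈ cell c ↔ IsCorner c x y := by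
  rw [mem_cell, IsCorner]
  simp only
  norm_cast
  omega

theorem lattice_mem_cells {K : Set (ℤ × ℤ)} {x y : ℤ} :
    ((x : ℝ), (y : ℝ)) ∈ cells K ↔ Touches K x y := by
  rw [mem_cells, Touches]
  simp only [lattice_mem_cell]

/-- Adding some of the components outside a box to the box gives an orthogonal polygon. -/
theorem isOrthogonalPolygon_union (hFfin : F.Finite) (hF : EdgeConn F) (hFc : EdgeConn Fᶜ)
    (hn : 0 < n) (hBF : box a b n ⊆ F) {S : Square} (hS : S.region = cells (box a b n))
    {𝒞 : Set (Set (ℝ × ℝ))} (h𝒞 : 𝒞 ⊆ components (cells F) S) :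
    IsOrthogonalPolygon (S.region ∪ ⋃₀ 𝒞) := by
  -- A cell minus the box is connected, so as soon as it meets a component in `𝒞` it lies in that
  -- component. Hence `G` is closed under adjacency off the box.
  set G : Set (ℤ × ℤ) := {c | c ∈ F \ box a b n ∧ cell c \ cells (box a b n) ⊆ ⋃₀ 𝒞} with hGdef
  have habsorb : ∀ c ∈ F \ box a b n, ∀ q ∈ cell c \ cells (box a b n), q ∈ ⋃₀ 𝒞 → c ∈ G := by
    rintro c hc q hq ⟨C, hC, hqC⟩
    refine ⟨hc, ?_⟩
    obtain ⟨p, -, rfl⟩ := h𝒞 hC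
    rw [hS] at hqC hC
    exact (cell_diff_subset_component hc hq hqC).trans (Set.subset_sUnion_of_mem hC)
  have hG : G ⊆ F \ box a b n := fun c hc => hc.1
  have hclosed : ∀ c ∈ G, ∀ d ∈ F \ box a b n, Adj c d → d ∈ G := by
    intro c hc d hd hcd
    obtain ⟨m, hm1, hm2⟩ := exists_mem_both_of_adj (hG hc).2 hd.2 hcd
    exact habsorb d hd m hm2 (hc.2 hm1)
  have hne : (box a b n).Nonempty := ⟨(a, b), by simp only [box, Set.mem_ofPred_eq]; omega⟩
  have e : S.region ∪ ⋃₀ 𝒞 = cells (box a b n ∪ G) := by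
    rw [hS]
    ext p
    constructor
    · rintro (h | ⟨C, hC, hpC⟩)
      · obtain ⟨c, hc, hpc⟩ := mem_cells.1 h
        exact mem_cells.2 ⟨c, Or.inl hc, hpc⟩
      · have hpX : p ∈ cells F \ cells (box a b n) := by
          obtain ⟨q, -, rfl⟩ := h𝒞 hC
          rw [← hS]
          exact connectedComponentIn_subset _ _ hpC
        obtain ⟨c, hc, hpc⟩ := exists_of_mem_diff hpX
        exact mem_cells.2 ⟨c, Or.inr (habsorb c hc p hpc ⟨C, hC, hpC⟩), hpc.1⟩
    · intro h
      by_cases hpB : p ∈ cells (box a b n)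
      · exact Or.inl hpB
      obtain ⟨c, hc | hc, hpc⟩ := mem_cells.1 h
      · exact Or.inl (cell_subset_cells hc hpc)
      · exact Or.inr (hc.2 ⟨hpc, hpB⟩)
  rw [e]
  exact isOrthogonalPolygon_cells (hFfin.subset (Set.union_subset hBF fun c hc => (hG hc).1))
    (hne.mono Set.subset_union_left) (edgeConn_union hF (edgeConn_box a b n) hBF hne hG hclosed)
    (edgeConn_compl_union hFfin hFc hBF hG hclosed)

/-- A point strictly between the ends of a side of a box only lies in the box and in cells along
this side. -/
theorem side_coord {c : ℤ × ℤ} {x y : ℝ} (hc : c ∉ box a b n) (hn : 0 < n)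
    (h : (x, y) ∈ cell c) (h1 : (a : ℝ) < x) (h2 : x < a + n) :
    (y = b + n → (a ≤ c.1 ∧ c.1 < a + n) ∧ c.2 = b + n) ∧
      (y = b → (a ≤ c.1 ∧ c.1 < a + n) ∧ c.2 = b - 1) := by
  obtain ⟨⟨h3, h4⟩, h5, h6⟩ := mem_cell.1 h
  simp only at h3 h4 h5 h6
  have e1 : a < c.1 + 1 := by exact_mod_cast h1.trans_le h4
  have e2 : c.1 < a + n := by exact_mod_cast h3.trans_lt h2
  simp only [box, Set.mem_ofPred_eq] at hc
  constructor
  · rintro rfl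
    have e3 : c.2 ≤ b + n := by exact_mod_cast h5
    have e4 : b + n ≤ c.2 + 1 := by exact_mod_cast h6
    omega
  · rintro rfl
    have e3 : c.2 ≤ b := by exact_mod_cast h5
    have e4 : b ≤ c.2 + 1 := by exact_mod_cast h6
    omega

theorem two_points_interval {α β : ℝ} {X : ℝ → Prop} {x y : ℝ} (hx : x ∈ Set.Icc α β)
    (hy : y ∈ Set.Icc α β) (hxy : x ≠ y) (hX : X x) (hY : X y) :
    (∃ z, α < z ∧ z < β ∧ X z) ∨ (X α ∧ X β) := by
  by_contra! h
  obtain ⟨h1, h2⟩ := h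
  have k1 : x = α ∨ x = β := by
    by_contra! h'
    exact h1 x (lt_of_le_of_ne hx.1 h'.1.symm) (lt_of_le_of_ne hx.2 h'.2) hX
  have k2 : y = α ∨ y = β := by
    by_contra! h'
    exact h1 y (lt_of_le_of_ne hy.1 h'.1.symm) (lt_of_le_of_ne hy.2 h'.2) hY
  rcases k1 with rfl | rfl <;> rcases k2 with rfl | rfl
  · exact hxy rfl
  · exact h2 hX hY
  · exact h2 hY hX
  · exact hxy rfl

theorem nontrivial_horizontal {K : Set (ℤ × ℤ)} {y : ℝ} :
    (cells K ∩ Set.Icc (a : ℝ) (a + n) ×ˢ {y}).Nontrivial →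
      (∃ z, (a : ℝ) < z ∧ z < a + n ∧ (z, y) ∈ cells K) ∨
        (((a : ℝ), y) ∈ cells K ∧ ((a : ℝ) + n, y) ∈ cells K) := by
  rintro ⟨⟨x1, y1⟩, ⟨h1, h2, h3⟩, ⟨x2, y2⟩, ⟨h4, h5, h6⟩, hne⟩
  simp only [Set.mem_singleton_iff] at h3 h6 h2 h5
  subst h3 h6
  exact two_points_interval (X := fun t => (t, _) ∈ cells K) h2 h5
    (fun h => hne (by rw [h])) h1 h4

theorem nontrivial_vertical {K : Set (ℤ × ℤ)} {x : ℝ} :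
    (cells K ∩ {x} ×ˢ Set.Icc (b : ℝ) (b + n)).Nontrivial →
      (∃ z, (b : ℝ) < z ∧ z < b + n ∧ (x, z) ∈ cells K) ∨
        ((x, (b : ℝ)) ∈ cells K ∧ (x, (b : ℝ) + n) ∈ cells K) := by
  rintro ⟨⟨x1, y1⟩, ⟨h1, h2, h3⟩, ⟨x2, y2⟩, ⟨h4, h5, h6⟩, hne⟩
  simp only [Set.mem_singleton_iff] at h3 h6 h2 h5
  subst h2 h5
  exact two_points_interval (X := fun t => (_, t) ∈ cells K) h3 h6
    (fun h => hne (by rw [h])) h1 h4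

/-- Two points on a side give either a point strictly inside it, and then a cell along it, or both
of its corners. In the second case the last four fields of `RingType` provide the cell. -/
theorem nontrivial_side_iff {K : Set (ℤ × ℤ)} (hn : 0 < n) {S : Square} (hx : S.x = a)
    (hy : S.y = b) (hl : S.len = n) (hK : K ⊆ (box a b n)ᶜ) (h : RingType a b n K) (d : Side) :
    (cells K ∩ S.side d).Nontrivial ↔ TouchesSide a b n K d := by
  have hhor : ∀ {z y : ℝ}, (a : ℝ) < z → z < a + n → (z, y) ∈ cells K →
      (y = b + n → TouchesSide a b n K .top) ∧ (y = b → TouchesSide a b n K .bottom) := by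
    intro z y h1 h2 h3
    obtain ⟨⟨c1, c2⟩, hc, hzc⟩ := mem_cells.1 h3
    have := side_coord (hK hc) hn hzc h1 h2
    refine ⟨fun e => ?_, fun e => ?_⟩
    · obtain ⟨hc1, rfl⟩ := this.1 e
      exact ⟨c1, hc1.1, hc1.2, hc⟩
    · obtain ⟨hc1, rfl⟩ := this.2 e
      exact ⟨c1, hc1.1, hc1.2, hc⟩
  have hver : ∀ {x z : ℝ}, (b : ℝ) < z → z < b + n → (x, z) ∈ cells K →
      (x = a + n → TouchesSide a b n K .right) ∧ (x = a → TouchesSide a b n K .left) := by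
    intro x z h1 h2 h3
    obtain ⟨⟨c1, c2⟩, hc, hzc⟩ := mem_cells.1 h3
    have hsw : (c2, c1) ∉ box b a n := fun h => hK hc ⟨h.2, h.1⟩
    have := side_coord hsw hn (show (z, x) ∈ cell (c2, c1) from ⟨hzc.2, hzc.1⟩) h1 h2
    refine ⟨fun e => ?_, fun e => ?_⟩
    · obtain ⟨hc1, hc2⟩ := this.1 e
      exact ⟨c2, hc1.1, hc1.2, by rw [← show c1 = a + n from hc2]; exact hc⟩
    · obtain ⟨hc1, hc2⟩ := this.2 e
      exact ⟨c2, hc1.1, hc1.2, by rw [← show c1 = a - 1 from hc2]; exact hc⟩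
  have hlat : ∀ {p q : ℝ} (i j : ℤ), (p, q) ∈ cells K → p = i → q = j → Touches K i j := by
    rintro p q i j h1 rfl rfl
    exact lattice_mem_cells.1 h1
  have hmem : ∀ {c : ℤ × ℤ} {p : ℝ × ℝ}, c ∈ K → p ∈ cell c → p ∈ cells K := fun hc hp =>
    cell_subset_cells hc hp
  cases d <;> simp only [Square.side, hx, hy, hl]
  · constructor
    · intro hnt
      rcases nontrivial_horizontal hnt with ⟨z, h1, h2, h3⟩ | ⟨h1, h2⟩
      · exact (hhor h1 h2 h3).1 rfl
      · exact h.top (hlat _ _ h1 rfl (by push_cast; rfl))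
          (hlat _ _ h2 (by push_cast; rfl) (by push_cast; rfl))
    · rintro ⟨x, h1, h2, h3⟩
      have e1 : (a : ℝ) ≤ x := by exact_mod_cast h1
      have e2 : (x : ℝ) + 1 ≤ a + n := by exact_mod_cast h2
      refine ⟨(x, b + n), ⟨hmem h3 ?_, ?_, rfl⟩, (x + 1, b + n), ⟨hmem h3 ?_, ?_, rfl⟩, by simp⟩ <;>
        simp [mem_cell] <;> constructor <;> linarith
  · constructor
    · intro hnt
      rcases nontrivial_horizontal hnt with ⟨z, h1, h2, h3⟩ | ⟨h1, h2⟩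
      · exact (hhor h1 h2 h3).2 rfl
      · exact h.bottom (hlat _ _ h1 rfl rfl) (hlat _ _ h2 (by push_cast; rfl) rfl)
    · rintro ⟨x, h1, h2, h3⟩
      have e1 : (a : ℝ) ≤ x := by exact_mod_cast h1
      have e2 : (x : ℝ) + 1 ≤ a + n := by exact_mod_cast h2
      refine ⟨(x, b), ⟨hmem h3 ?_, ?_, rfl⟩, (x + 1, b), ⟨hmem h3 ?_, ?_, rfl⟩, by simp⟩ <;>
        simp [mem_cell] <;> constructor <;> linarith
  · constructor
    · intro hnt
      rcases nontrivial_vertical hnt with ⟨z, h1, h2, h3⟩ | ⟨h1, h2⟩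
      · exact (hver h1 h2 h3).2 rfl
      · exact h.left (hlat _ _ h1 rfl rfl) (hlat _ _ h2 rfl (by push_cast; rfl))
    · rintro ⟨x, h1, h2, h3⟩
      have e1 : (b : ℝ) ≤ x := by exact_mod_cast h1
      have e2 : (x : ℝ) + 1 ≤ b + n := by exact_mod_cast h2
      refine ⟨(a, x), ⟨hmem h3 ?_, rfl, ?_⟩, (a, x + 1), ⟨hmem h3 ?_, rfl, ?_⟩, by simp⟩ <;>
        simp [mem_cell] <;> constructor <;> linarith
  · constructor
    · intro hnt
      rcases nontrivial_vertical hnt with ⟨z, h1, h2, h3⟩ | ⟨h1, h2⟩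
      · exact (hver h1 h2 h3).1 rfl
      · exact h.right (hlat _ _ h1 (by push_cast; rfl) rfl)
          (hlat _ _ h2 (by push_cast; rfl) (by push_cast; rfl))
    · rintro ⟨x, h1, h2, h3⟩
      have e1 : (b : ℝ) ≤ x := by exact_mod_cast h1
      have e2 : (x : ℝ) + 1 ≤ b + n := by exact_mod_cast h2
      refine ⟨(a + n, x), ⟨hmem h3 ?_, rfl, ?_⟩, (a + n, x + 1), ⟨hmem h3 ?_, rfl, ?_⟩, by simp⟩ <;>
        simp [mem_cell] <;> constructor <;> linarith

/-- Opposite sides are disjoint since `n` is positive; adjacent sides share one lattice point, which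
`RingType` says is touched. -/
theorem corner_mem_cells {K : Set (ℤ × ℤ)} (hn : 0 < n) {S : Square} (hx : S.x = a)
    (hy : S.y = b) (hl : S.len = n) (h : RingType a b n K) {d d' : Side}
    (hd : TouchesSide a b n K d) (hd' : TouchesSide a b n K d') (hne : d ≠ d') :
    S.side d ∩ S.side d' ⊆ cells K := by
  have hn' : (0 : ℝ) < n := by exact_mod_cast hn
  have hlat : ∀ {p q : ℝ} (i j : ℤ), Touches K i j → p = i → q = j → (p, q) ∈ cells K := by
    rintro p q i j h1 rfl rfl
    exact lattice_mem_cells.2 h1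
  rintro ⟨p, q⟩ ⟨h1, h2⟩
  cases d <;> cases d' <;> first | exact absurd rfl hne | skip
  all_goals
    simp only [Square.side, hx, hy, hl, Set.mem_prod, Set.mem_singleton_iff] at h1 h2
  · exfalso; linarith [h1.2, h2.2]
  · exact hlat _ _ (h.top_left hd hd') h2.1 (by push_cast; exact h1.2)
  · exact hlat _ _ (h.top_right hd hd') (by push_cast; exact h2.1) (by push_cast; exact h1.2)
  · exfalso; linarith [h1.2, h2.2]
  · exact hlat _ _ (h.bottom_left hd hd') h2.1 h1.2
  · exact hlat _ _ (h.bottom_right hd hd') (by push_cast; exact h2.1) h1.2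
  · exact hlat _ _ (h.top_left hd' hd) h1.1 (by push_cast; exact h2.2)
  · exact hlat _ _ (h.bottom_left hd' hd) h1.1 h2.2
  · exfalso; linarith [h1.1, h2.1]
  · exact hlat _ _ (h.top_right hd' hd) (by push_cast; exact h1.1) (by push_cast; exact h2.2)
  · exact hlat _ _ (h.bottom_right hd' hd) (by push_cast; exact h1.1) h2.2
  · exfalso; linarith [h1.1, h2.1]

/-- The set of sides with given indicators. -/
def sideSet (t b l r : Bool) : Finset Side :=
  (if t then {.top} else ∅) ∪ (if b then {.bottom} else ∅) ∪ (if l then {.left} else ∅) ∪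
    if r then {.right} else ∅

/-- Of the sixteen sets of sides the hypotheses exclude four: the empty one, the two pairs of
opposite sides, and the full one. -/
theorem sideSet_mem_types : ∀ t b l r : Bool, (t = true ∨ b = true ∨ l = true ∨ r = true) →
    (t = true → b = true → l = true ∨ r = true) → (l = true → r = true → t = true ∨ b = true) →
    (t = true → b = true → l = true → ¬ r = true) → sideSet t b l r ∈ types := by
  intro t b l r h1 h2 h3 h4
  cases t <;> cases b <;> cases l <;> cases r <;>
    first
    | (simp at h1 h2 h3 h4; done)
    | (clear h1 h2 h3 h4; decide)

theorem mem_sideSet (t b l r : Bool) (d : Side) : d ∈ sideSet t b l r ↔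
    (match d with
      | .top => t
      | .bottom => b
      | .left => l
      | .right => r) = true := by
  cases d <;> cases t <;> cases b <;> cases l <;> cases r <;> decide

open Classical in
/-- Every component outside a maximal corner box has one of the twelve types. -/
theorem exists_type {p q : ℤ} (hp : p = 0 ∨ p = 1) (hq : q = 0 ∨ q = 1)
    (hbox : IsMaximalCornerBox F a b n p q) {S : Square} (hx : S.x = a) (hy : S.y = b)
    (hl : S.len = n) {C : Set (ℝ × ℝ)} (hC : C ∈ components (cells F) S) :
    ∃ I ∈ types, HasType S I C := by
  obtain ⟨z, hz, rfl⟩ := hC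
  rw [Square.region_eq_cells hbox.pos hx hy hl] at hz ⊢
  obtain ⟨K, hK, e⟩ := exists_isClass hbox.conn hbox.conn_compl hz
  have hKB : K ⊆ (box a b n)ᶜ := fun c hc => (hK.sub hc).2
  have hring := hbox.ringType hp hq hK
  rw [e]
  set I : Finset Side := sideSet (decide (TouchesSide a b n K .top))
    (decide (TouchesSide a b n K .bottom)) (decide (TouchesSide a b n K .left))
    (decide (TouchesSide a b n K .right)) with hI
  have hmem : ∀ d, d ∈ I ↔ TouchesSide a b n K d := by
    intro d
    rw [hI, mem_sideSet]
    cases d <;> simp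
  refine ⟨I, ?_, ?_, ?_⟩
  · apply sideSet_mem_types
    · simpa using hring.some_side
    · simpa using hring.top_bottom
    · simpa using hring.left_right
    · simpa using hring.not_all
  · intro d
    rw [closure_cells_diff hKB, hmem]
    exact nontrivial_side_iff hbox.pos hx hy hl hKB hring d
  · intro d hd d' hd' hne
    rw [closure_cells_diff hKB]
    exact corner_mem_cells hbox.pos hx hy hl hring ((hmem d).1 hd) ((hmem d').1 hd') hne

end

/-! ### Squares at a convex vertex, and the maximal corner square as a box of cells. -/

section

open Topology

/-- If `v` were not the end of the interval on the forbidden side, the point at distance `ε / 2`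
from `v` on that side, cut off at the end of the interval, would have the wrong sign. -/
theorem eventually_sign_of_near {x l v σ : ℝ} (hx : x ≤ v) (hv : v ≤ x + l)
    (h : ∀ᶠ t in 𝓝 v, x ≤ t → t ≤ x + l → 0 ≤ σ * (t - v)) :
    (σ = 1 → x = v) ∧ (σ = -1 → x + l = v) := by
  obtain ⟨ε, hε, h⟩ := Metric.eventually_nhds_iff.1 h
  constructor
  · rintro rfl
    by_contra hne
    have hlt : x < v := lt_of_le_of_ne hx hne
    set t := max x (v - ε / 2) with ht
    have h1 : t < v := max_lt hlt (by linarith)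
    have h2 := h (y := t) (by
      rw [Real.dist_eq, abs_lt]
      constructor <;> linarith [le_max_right x (v - ε / 2)]) (le_max_left _ _) (by linarith)
    linarith
  · rintro rfl
    by_contra hne
    have hlt : v < x + l := lt_of_le_of_ne hv (Ne.symm hne)
    set t := min (x + l) (v + ε / 2) with ht
    have h1 : v < t := lt_min hlt (by linarith)
    have h2 := h (y := t) (by
      rw [Real.dist_eq, abs_lt]
      constructor <;> linarith [min_le_right (x + l) (v + ε / 2)]) (by linarith)
      (min_le_left _ _)
    linarith

/-- The local form of a region at a convex vertex, with the directions encoded by `0` and `1`. -/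
structure IsQuadrantAt (P : Set (ℝ × ℝ)) (v : ℝ × ℝ) (p q : ℤ) : Prop where
  left : p = 0 ∨ p = 1
  right : q = 0 ∨ q = 1
  local_iff : ∀ᶠ z in 𝓝 v, z ∈ P ↔
    0 ≤ (1 - 2 * p : ℝ) * (z.1 - v.1) ∧ 0 ≤ (1 - 2 * q : ℝ) * (z.2 - v.2)

theorem IsConvexVertex.exists_quadrant {P : Set (ℝ × ℝ)} {v : ℝ × ℝ} (h : IsConvexVertex P v) :
    ∃ p q : ℤ, IsQuadrantAt P v p q := by
  obtain ⟨σ, τ, hσ, hτ, h⟩ := h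
  have : ∀ ρ : ℝ, ρ = 1 ∨ ρ = -1 → ∃ p : ℤ, (p = 0 ∨ p = 1) ∧ ρ = 1 - 2 * p := by
    rintro ρ (rfl | rfl)
    · exact ⟨0, Or.inl rfl, by simp⟩
    · exact ⟨1, Or.inr rfl, by norm_num⟩
  obtain ⟨p, hp, rfl⟩ := this σ hσ
  obtain ⟨q, hq, rfl⟩ := this τ hτ
  exact ⟨p, q, hp, hq, h⟩

theorem sign_corner {x l v : ℝ} {p : ℤ} (hp : p = 0 ∨ p = 1)
    (h : ((1 - 2 * p : ℝ) = 1 → x = v) ∧ ((1 - 2 * p : ℝ) = -1 → x + l = v)) :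
    x + p * l = v := by
  rcases hp with rfl | rfl
  · simpa using h.1
  · have := h.2 (by norm_num)
    simpa using this

theorem IsQuadrantAt.mem {P : Set (ℝ × ℝ)} {v : ℝ × ℝ} {p q : ℤ} (h : IsQuadrantAt P v p q) :
    v ∈ P := h.local_iff.self_of_nhds.2 (by simp)

theorem IsQuadrantAt.eventually_fst {P : Set (ℝ × ℝ)} {v : ℝ × ℝ} {p q : ℤ}
    (h : IsQuadrantAt P v p q) :
    ∀ᶠ t in 𝓝 v.1, (t, v.2) ∈ P → 0 ≤ (1 - 2 * p : ℝ) * (t - v.1) := by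
  have hc : Filter.Tendsto (fun t => (t, v.2)) (𝓝 v.1) (𝓝 v) :=
    (Continuous.prodMk_left v.2).tendsto v.1
  filter_upwards [hc.eventually h.local_iff] with t ht htP using (ht.1 htP).1

theorem IsQuadrantAt.eventually_snd {P : Set (ℝ × ℝ)} {v : ℝ × ℝ} {p q : ℤ}
    (h : IsQuadrantAt P v p q) :
    ∀ᶠ t in 𝓝 v.2, (v.1, t) ∈ P → 0 ≤ (1 - 2 * q : ℝ) * (t - v.2) := by
  have hc : Filter.Tendsto (fun t => (v.1, t)) (𝓝 v.2) (𝓝 v) :=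
    (Continuous.prodMk_right v.1).tendsto v.2
  filter_upwards [hc.eventually h.local_iff] with t ht htP using (ht.1 htP).2

/-- A valid square that covers a convex vertex has the vertex as a corner. -/
theorem IsQuadrantAt.corner_eq {P : Set (ℝ × ℝ)} {v : ℝ × ℝ} {p q : ℤ}
    (h : IsQuadrantAt P v p q) {T : Square} (hT : IsValidSquare P T) (hv : v ∈ T.region) :
    T.x + p * T.len = v.1 ∧ T.y + q * T.len = v.2 := by
  obtain ⟨⟨h1, h2⟩, h3, h4⟩ := hv
  constructor
  · refine sign_corner h.left (eventually_sign_of_near h1 h2 ?_)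
    filter_upwards [h.eventually_fst] with t ht ht1 ht2
    exact ht (hT ⟨⟨ht1, ht2⟩, h3, h4⟩)
  · refine sign_corner h.right (eventually_sign_of_near h3 h4 ?_)
    filter_upwards [h.eventually_snd] with t ht ht1 ht2
    exact ht (hT ⟨⟨h1, h2⟩, ht1, ht2⟩)

theorem interval_subset {x y l m v : ℝ} {p : ℤ} (hp : p = 0 ∨ p = 1) (h1 : x + p * l = v)
    (h2 : y + p * m = v) (hlm : l ≤ m) : Set.Icc x (x + l) ⊆ Set.Icc y (y + m) := by
  rintro t ⟨ht1, ht2⟩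
  rcases hp with rfl | rfl <;> push_cast at h1 h2 <;> constructor <;> linarith

theorem region_subset_of_corner {v : ℝ × ℝ} {p q : ℤ} (hp : p = 0 ∨ p = 1) (hq : q = 0 ∨ q = 1)
    {S T : Square} (hS : S.x + p * S.len = v.1 ∧ S.y + q * S.len = v.2)
    (hT : T.x + p * T.len = v.1 ∧ T.y + q * T.len = v.2) (h : S.len ≤ T.len) :
    S.region ⊆ T.region :=
  Set.prod_mono (interval_subset hp hS.1 hT.1 h) (interval_subset hq hS.2 hT.2 h)

/-- All valid squares that cover a convex vertex lie in its maximal corner square. -/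
theorem IsMaximalCornerSquare.region_subset {P : Set (ℝ × ℝ)} {v : ℝ × ℝ}
    (hv : IsConvexVertex P v) {S : Square} (hS : IsMaximalCornerSquare P v S) {T : Square}
    (hT : IsValidSquare P T) (hvT : v ∈ T.region) : T.region ⊆ S.region := by
  obtain ⟨p, q, h⟩ := hv.exists_quadrant
  have h1 := h.corner_eq hS.1.1 hS.2
  have h2 := h.corner_eq hT hvT
  rcases le_or_gt T.len S.len with hle | hlt
  · exact region_subset_of_corner h.left h.right h2 h1 hle
  · exact absurd (pow_lt_pow_left₀ hlt S.len_pos.le two_ne_zero)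
      (hS.1.2 T hT (region_subset_of_corner h.left h.right h1 h2 hlt.le))

theorem int_of_eventually_sign {v σ : ℝ} (hσ : σ = 1 ∨ σ = -1)
    {k : ℤ} (h1 : (k : ℝ) ≤ v) (h2 : v ≤ k + 1)
    (h : ∀ᶠ t in 𝓝 v, (k : ℝ) ≤ t → t ≤ k + 1 → 0 ≤ σ * (t - v)) : ∃ m : ℤ, v = m := by
  have := eventually_sign_of_near h1 h2 h
  rcases hσ with hσ | hσ
  · exact ⟨k, (this.1 hσ).symm⟩
  · exact ⟨k + 1, by push_cast; exact (this.2 hσ).symm⟩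

theorem sign_cases {p : ℤ} (hp : p = 0 ∨ p = 1) :
    (1 - 2 * p : ℝ) = 1 ∨ (1 - 2 * p : ℝ) = -1 := by
  rcases hp with rfl | rfl <;> norm_num

/-- Convex vertices of a union of cells are lattice points. -/
theorem IsQuadrantAt.exists_int {F : Set (ℤ × ℤ)} {v : ℝ × ℝ} {p q : ℤ}
    (h : IsQuadrantAt (cells F) v p q) : ∃ m k : ℤ, v = ((m : ℝ), (k : ℝ)) := by
  obtain ⟨c, hc, hvc⟩ := mem_cells.1 h.mem
  have hsub := cell_subset_cells hc
  obtain ⟨m, hm⟩ := int_of_eventually_sign (sign_cases h.left) hvc.1.1 hvc.1.2 (by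
    filter_upwards [h.eventually_fst] with t ht h1 h2 using ht (hsub ⟨⟨h1, h2⟩, hvc.2⟩))
  obtain ⟨k, hk⟩ := int_of_eventually_sign (sign_cases h.right) hvc.2.1 hvc.2.2 (by
    filter_upwards [h.eventually_snd] with t ht h1 h2 using ht (hsub ⟨hvc.1, h1, h2⟩))
  exact ⟨m, k, Prod.ext hm hk⟩

/-- The interval starts at `m` in the direction given by `p` and is longer than `n - 1`, so it
enters each of the first `n` unit intervals. The witness is the midpoint of the overlap. -/
theorem exists_mem_Ioo_of_corner {l : ℝ} {m n k p : ℤ} (hp : p = 0 ∨ p = 1)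
    (h1 : (n : ℝ) - 1 < l) (hk1 : m - p * n ≤ k)
    (hk2 : k < m - p * n + n) {x : ℝ} (hx : x + p * l = m) :
    ∃ z, z ∈ Set.Ioo (k : ℝ) (k + 1) ∧ z ∈ Set.Icc x (x + l) := by
  have e1 : (m : ℝ) - p * n ≤ k := by exact_mod_cast hk1
  have e2 : (k : ℝ) + 1 ≤ m - p * n + n := by exact_mod_cast hk2
  rcases hp with rfl | rfl
  · simp only [Int.cast_zero, zero_mul, add_zero, sub_zero] at hx e1 e2
    have h3 := min_le_left ((k : ℝ) + 1) (x + l)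
    have h4 := min_le_right ((k : ℝ) + 1) (x + l)
    have h5 : (k : ℝ) < min ((k : ℝ) + 1) (x + l) := lt_min (by linarith) (by linarith)
    exact ⟨(k + min ((k : ℝ) + 1) (x + l)) / 2, ⟨by linarith, by linarith⟩, by linarith,
      by linarith⟩
  · simp only [Int.cast_one, one_mul] at hx e1 e2
    have h3 := le_max_left (k : ℝ) x
    have h4 := le_max_right (k : ℝ) x
    have h5 : max (k : ℝ) x < k + 1 := max_lt (by linarith) (by linarith)
    exact ⟨(max (k : ℝ) x + (k + 1)) / 2, ⟨by linarith, by linarith⟩, by linarith, by linarith⟩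

/-- Among the two unit intervals ending at `m`, the sign of `z - m` selects the one on the side of
the quadrant, which belongs to the box. -/
theorem corner_coord {p n m k : ℤ} (hp : p = 0 ∨ p = 1) {z : ℝ} (h1 : (k : ℝ) < z)
    (h2 : z < k + 1) (h3 : 0 ≤ (1 - 2 * p : ℝ) * (z - m)) (hk : m = k ∨ m = k + 1) (hn : 0 < n) :
    m - p * n ≤ k ∧ k < m - p * n + n := by
  rcases hp with rfl | rfl
  · rcases hk with rfl | rfl
    · omega
    · exfalso; push_cast at h3; linarith
  · rcases hk with rfl | rfl
    · exfalso; push_cast at h3; linarith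
    · omega

/-- The maximal corner square of a convex vertex consists of the cells of a maximal corner box. -/
theorem exists_isMaximalCornerBox {F : Set (ℤ × ℤ)} (hF : EdgeConn F) (hFc : EdgeConn Fᶜ)
    {v : ℝ × ℝ} (hv : IsConvexVertex (cells F) v) {S : Square}
    (hS : IsMaximalCornerSquare (cells F) v S) : ∃ a b n p q : ℤ, (p = 0 ∨ p = 1) ∧
      (q = 0 ∨ q = 1) ∧ S.x = a ∧ S.y = b ∧ S.len = n ∧ IsMaximalCornerBox F a b n p q := by
  obtain ⟨p, q, h⟩ := hv.exists_quadrant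
  obtain ⟨m, k, rfl⟩ := h.exists_int
  obtain ⟨hx, hy⟩ := h.corner_eq hS.1.1 hS.2
  simp only at hx hy
  have hn : 0 < ⌈S.len⌉ := Int.ceil_pos.2 S.len_pos
  set n := ⌈S.len⌉ with hndef
  have hn1 : (n : ℝ) - 1 < S.len := by linarith [Int.ceil_lt_add_one S.len]
  have hn2 : S.len ≤ n := Int.le_ceil _
  have hnR : (0 : ℝ) < n := by exact_mod_cast hn
  -- `n` is `S.len` rounded up, so `S` meets the interior of every cell of the `n`-box at the
  -- vertex, and all these cells lie in `F`. The square of side `n` is then valid, and maximality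
  -- gives `S.len = n`.
  have hsub : box (m - p * n) (k - q * n) n ⊆ F := by
    rintro ⟨c1, c2⟩ ⟨⟨h1, h2⟩, h3, h4⟩
    obtain ⟨z1, hz1, hz1'⟩ := exists_mem_Ioo_of_corner h.left hn1 h1 h2 hx
    obtain ⟨z2, hz2, hz2'⟩ := exists_mem_Ioo_of_corner h.right hn1 h3 h4 hy
    exact mem_of_openCell_inter (p := (z1, z2)) ⟨hz1, hz2⟩ (hS.1.1 ⟨hz1', hz2'⟩)
  have hlen : S.len = n := by
    by_contra hne
    have hlt : S.len < n := lt_of_le_of_ne hn2 hne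
    let T : Square := ⟨(m - p * n : ℤ), (k - q * n : ℤ), n, hnR⟩
    refine hS.1.2 T ?_ (region_subset_of_corner (v := (m, k)) h.left h.right ⟨hx, hy⟩ ?_ hn2)
      (pow_lt_pow_left₀ hlt S.len_pos.le two_ne_zero)
    · rw [IsValidSquare, Square.region_eq_cells (S := T) hn rfl rfl rfl]
      exact Set.biUnion_subset_biUnion_left hsub
    · simp only [T]; push_cast; constructor <;> ring
  have hx' : S.x = (m - p * n : ℤ) := by push_cast; rw [← hx, hlen]; ring
  have hy' : S.y = (k - q * n : ℤ) := by push_cast; rw [← hy, hlen]; ring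
  refine ⟨m - p * n, k - q * n, n, p, q, h.left, h.right, hx', hy', hlen, hF, hFc, hn, hsub,
    ?_, ?_⟩
  · rintro c hc hcc
    -- A cell of `F` at the vertex has interior points close to it; these lie in the quadrant, which
    -- places the cell in the box.
    rw [sub_add_cancel, sub_add_cancel] at hcc
    obtain ⟨z, hz1, hz2⟩ := mem_closure_iff_nhds.1
      (cell_subset_closure_openCell c (lattice_mem_cell.2 hcc)) _ h.local_iff
    have hz := hz1.1 (cell_subset_cells hc (openCell_subset_cell c hz2))
    exact ⟨corner_coord h.left hz2.1.1 hz2.1.2 hz.1 hcc.1 hn,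
      corner_coord h.right hz2.2.1 hz2.2.2 hz.2 hcc.2 hn⟩
  · intro hmax
    -- The square with side one longer and the same corner at the vertex.
    let T : Square := ⟨(m - p * n - p : ℤ), (k - q * n - q : ℤ), (n + 1 : ℤ), by
      push_cast; linarith⟩
    refine hS.1.2 T ?_ (region_subset_of_corner (v := (m, k)) h.left h.right ⟨hx, hy⟩ ?_ ?_)
      (pow_lt_pow_left₀ ?_ S.len_pos.le two_ne_zero)
    · rw [IsValidSquare, Square.region_eq_cells (S := T) (by omega) rfl rfl rfl]
      exact Set.biUnion_subset_biUnion_left hmax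
    · simp only [T]; push_cast; constructor <;> ring
    · simp only [T]; push_cast; linarith
    · simp only [T]; push_cast; linarith

/-! ### Connectedness of the difference of two squares. -/

/-- The part of a square beyond the line through a side of another square. -/
def beyond (T S : Square) : Side → Set (ℝ × ℝ)
  | .top => Set.Icc T.x (T.x + T.len) ×ˢ (Set.Icc T.y (T.y + T.len) ∩ Set.Ioi (S.y + S.len))
  | .bottom => Set.Icc T.x (T.x + T.len) ×ˢ (Set.Icc T.y (T.y + T.len) ∩ Set.Iio S.y)
  | .left => (Set.Icc T.x (T.x + T.len) ∩ Set.Iio S.x) ×ˢ Set.Icc T.y (T.y + T.len)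
  | .right => (Set.Icc T.x (T.x + T.len) ∩ Set.Ioi (S.x + S.len)) ×ˢ Set.Icc T.y (T.y + T.len)

theorem isPreconnected_beyond (T S : Square) (d : Side) : IsPreconnected (beyond T S d) := by
  cases d
  · exact isPreconnected_Icc.prod (Set.ordConnected_Icc.inter Set.ordConnected_Ioi).isPreconnected
  · exact isPreconnected_Icc.prod (Set.ordConnected_Icc.inter Set.ordConnected_Iio).isPreconnected
  · exact (Set.ordConnected_Icc.inter Set.ordConnected_Iio).isPreconnected.prod isPreconnected_Icc
  · exact (Set.ordConnected_Icc.inter Set.ordConnected_Ioi).isPreconnected.prod isPreconnected_Icc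

/-- A square minus another square is connected. -/
theorem isPreconnected_region_diff (T S : Square) : IsPreconnected (T.region \ S.region) := by
  have e : T.region \ S.region =
      ⋃ d ∈ {d : Side | (beyond T S d).Nonempty}, beyond T S d := by
    ext ⟨x, y⟩
    simp only [Set.mem_iUnion, Set.mem_ofPred_eq, exists_prop]
    constructor
    · rintro ⟨⟨h1, h2⟩, hS⟩
      simp only [Square.region, Set.mem_prod, Set.mem_Icc, not_and_or, not_le] at hS
      rcases hS with (h | h) | h | h
      · exact ⟨.left, ⟨_, ⟨h1, h⟩, h2⟩, ⟨h1, h⟩, h2⟩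
      · exact ⟨.right, ⟨_, ⟨h1, h⟩, h2⟩, ⟨h1, h⟩, h2⟩
      · exact ⟨.bottom, ⟨_, h1, h2, h⟩, h1, h2, h⟩
      · exact ⟨.top, ⟨_, h1, h2, h⟩, h1, h2, h⟩
    · rintro ⟨d, -, hd⟩
      cases d
      · exact ⟨⟨hd.1, hd.2.1⟩, fun h => absurd hd.2.2 (not_lt.2 h.2.2)⟩
      · exact ⟨⟨hd.1, hd.2.1⟩, fun h => absurd hd.2.2 (not_lt.2 h.2.1)⟩
      · exact ⟨⟨hd.1.1, hd.2⟩, fun h => absurd hd.1.2 (not_lt.2 h.1.1)⟩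
      · exact ⟨⟨hd.1.1, hd.2⟩, fun h => absurd hd.1.2 (not_lt.2 h.1.2)⟩
  have hl := T.len_pos
  have top_iff : (beyond T S .top).Nonempty ↔ S.y + S.len < T.y + T.len :=
    ⟨fun ⟨z, hz⟩ => lt_of_lt_of_le hz.2.2 hz.2.1.2, fun h => ⟨(T.x, T.y + T.len),
      ⟨le_rfl, by simp only; linarith⟩, ⟨by simp only; linarith, le_rfl⟩, h⟩⟩
  have bottom_iff : (beyond T S .bottom).Nonempty ↔ T.y < S.y :=
    ⟨fun ⟨z, hz⟩ => lt_of_le_of_lt hz.2.1.1 hz.2.2, fun h => ⟨(T.x, T.y),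
      ⟨le_rfl, by simp only; linarith⟩, ⟨le_rfl, by simp only; linarith⟩, h⟩⟩
  have left_iff : (beyond T S .left).Nonempty ↔ T.x < S.x :=
    ⟨fun ⟨z, hz⟩ => lt_of_le_of_lt hz.1.1.1 hz.1.2, fun h => ⟨(T.x, T.y),
      ⟨⟨le_rfl, by simp only; linarith⟩, h⟩, le_rfl, by simp only; linarith⟩⟩
  have right_iff : (beyond T S .right).Nonempty ↔ S.x + S.len < T.x + T.len :=
    ⟨fun ⟨z, hz⟩ => lt_of_lt_of_le hz.1.2 hz.1.1.2, fun h => ⟨(T.x + T.len, T.y),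
      ⟨⟨by simp only; linarith, le_rfl⟩, h⟩, le_rfl, by simp only; linarith⟩⟩
  have corner : ∀ d d' : Side, (d = .left ∨ d = .right) → (d' = .top ∨ d' = .bottom) →
      (beyond T S d).Nonempty → (beyond T S d').Nonempty →
      (beyond T S d ∩ beyond T S d').Nonempty := by
    rintro d d' (rfl | rfl) (rfl | rfl) ⟨z, hz⟩ ⟨w, hw⟩
    · exact ⟨(z.1, w.2), ⟨hz.1, hw.2.1⟩, hz.1.1, hw.2⟩
    · exact ⟨(z.1, w.2), ⟨hz.1, hw.2.1⟩, hz.1.1, hw.2⟩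
    · exact ⟨(z.1, w.2), ⟨hz.1, hw.2.1⟩, hz.1.1, hw.2⟩
    · exact ⟨(z.1, w.2), ⟨hz.1, hw.2.1⟩, hz.1.1, hw.2⟩
  rw [e]
  refine IsPreconnected.biUnion_of_reflTransGen (fun d _ => isPreconnected_beyond T S d) ?_
  set R : Side → Side → Prop := fun d d' =>
    (beyond T S d ∩ beyond T S d').Nonempty ∧ d ∈ {d : Side | (beyond T S d).Nonempty} with hR
  have hv : ∀ d d' : Side, (d = .left ∨ d = .right) → (d' = .top ∨ d' = .bottom) →
      (beyond T S d).Nonempty → (beyond T S d').Nonempty → R d d' ∧ R d' d :=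
    fun d d' h h' hne hne' => ⟨⟨corner d d' h h' hne hne', hne⟩,
      by rw [Set.inter_comm]; exact corner d d' h h' hne hne', hne'⟩
  have hrefl : ∀ d d', d = d' → Relation.ReflTransGen R d d' := by
    rintro d _ rfl; exact .refl
  have hlr : (beyond T S .left).Nonempty → (beyond T S .right).Nonempty →
      Relation.ReflTransGen R .left .right ∧ Relation.ReflTransGen R .right .left := by
    intro h1 h2
    -- `T` exceeds `S` on the left and on the right, so it is longer than `S`; being a square, it
    -- also exceeds `S` vertically, and this strip links the two.
    have h3 : (beyond T S .top).Nonempty ∨ (beyond T S .bottom).Nonempty := by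
      rw [top_iff, bottom_iff]
      rw [left_iff] at h1
      rw [right_iff] at h2
      by_contra! h
      linarith [h.1, h.2]
    rcases h3 with h3 | h3
    · have a1 := hv .left .top (Or.inl rfl) (Or.inl rfl) h1 h3
      have a2 := hv .right .top (Or.inr rfl) (Or.inl rfl) h2 h3
      exact ⟨.tail (.single a1.1) a2.2, .tail (.single a2.1) a1.2⟩
    · have a1 := hv .left .bottom (Or.inl rfl) (Or.inr rfl) h1 h3
      have a2 := hv .right .bottom (Or.inr rfl) (Or.inr rfl) h2 h3
      exact ⟨.tail (.single a1.1) a2.2, .tail (.single a2.1) a1.2⟩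
  have htb : (beyond T S .top).Nonempty → (beyond T S .bottom).Nonempty →
      Relation.ReflTransGen R .top .bottom ∧ Relation.ReflTransGen R .bottom .top := by
    intro h1 h2
    have h3 : (beyond T S .left).Nonempty ∨ (beyond T S .right).Nonempty := by
      rw [left_iff, right_iff]
      rw [top_iff] at h1
      rw [bottom_iff] at h2
      by_contra! h
      linarith [h.1, h.2]
    rcases h3 with h3 | h3
    · have a1 := hv .left .top (Or.inl rfl) (Or.inl rfl) h3 h1
      have a2 := hv .left .bottom (Or.inl rfl) (Or.inr rfl) h3 h2
      exact ⟨.tail (.single a1.2) a2.1, .tail (.single a2.2) a1.1⟩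
    · have a1 := hv .right .top (Or.inr rfl) (Or.inl rfl) h3 h1
      have a2 := hv .right .bottom (Or.inr rfl) (Or.inr rfl) h3 h2
      exact ⟨.tail (.single a1.2) a2.1, .tail (.single a2.2) a1.1⟩
  intro d hd d' hd'
  cases d <;> cases d'
  · exact .refl
  · exact (htb hd hd').1
  · exact .single (hv _ _ (Or.inl rfl) (Or.inl rfl) hd' hd).2
  · exact .single (hv _ _ (Or.inr rfl) (Or.inl rfl) hd' hd).2
  · exact (htb hd' hd).2
  · exact .refl
  · exact .single (hv _ _ (Or.inl rfl) (Or.inr rfl) hd' hd).2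
  · exact .single (hv _ _ (Or.inr rfl) (Or.inr rfl) hd' hd).2
  · exact .single (hv _ _ (Or.inl rfl) (Or.inl rfl) hd hd').1
  · exact .single (hv _ _ (Or.inl rfl) (Or.inr rfl) hd hd').1
  · exact .refl
  · exact (hlr hd hd').1
  · exact .single (hv _ _ (Or.inr rfl) (Or.inl rfl) hd hd').1
  · exact .single (hv _ _ (Or.inr rfl) (Or.inr rfl) hd hd').1
  · exact (hlr hd' hd).2
  · exact .refl

/-! ### Counting squares. -/

theorem opcs_le {P : Set (ℝ × ℝ)} {C : Finset Square} (h : IsCovering P C) : opcs P ≤ C.card :=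
  Nat.sInf_le ⟨C, h, rfl⟩

theorem IsCovering.exists_mem {P : Set (ℝ × ℝ)} {C : Finset Square} (h : IsCovering P C)
    {z : ℝ × ℝ} (hz : z ∈ P) : ∃ T ∈ C, z ∈ T.region := by
  simpa using h.2 hz

open Classical in
/-- The squares needed in addition to `S` are distributed among the pieces outside `S`, if every
square that covers `v` lies in `S` and every square outside `S` lies in a single piece. -/
theorem opcs_decomposition {P : Set (ℝ × ℝ)} {v : ℝ × ℝ} {S : Square} (hv : v ∈ P)
    (hvS : v ∈ S.region) (hS : IsValidSquare P S)
    (hsub : ∀ T, IsValidSquare P T → v ∈ T.region → T.region ⊆ S.region)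
    (𝒬 : Finset (Set (ℝ × ℝ)))
    (hP : ∃ C, IsCovering P C ∧ C.card = opcs P)
    (hQ : ∀ Q ∈ 𝒬, ∃ C, IsCovering (S.region ∪ Q) C ∧ C.card = opcs (S.region ∪ Q))
    (hQP : ∀ Q ∈ 𝒬, Q ⊆ P \ S.region) (hcover : ∀ z ∈ P \ S.region, ∃ Q ∈ 𝒬, z ∈ Q)
    (hdisj : ∀ Q ∈ 𝒬, ∀ Q' ∈ 𝒬, ∀ z, z ∈ Q → z ∈ Q' → Q = Q')
    (hsingle : ∀ T, IsValidSquare P T → (T.region \ S.region).Nonempty →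
      ∃ Q ∈ 𝒬, T.region \ S.region ⊆ Q) :
    (opcs P : ℤ) = (∑ Q ∈ 𝒬, (opcs (S.region ∪ Q) : ℤ)) - ((𝒬.card : ℤ) - 1) := by
  -- OPCS minus one is the additive quantity, and in this form the case without pieces, `P = S`,
  -- needs no separate treatment.
  have hsum : (∑ Q ∈ 𝒬, (opcs (S.region ∪ Q) : ℤ)) - ((𝒬.card : ℤ) - 1) =
      1 + ∑ Q ∈ 𝒬, ((opcs (S.region ∪ Q) : ℤ) - 1) := by
    rw [Finset.sum_sub_distrib, Finset.sum_const, nsmul_eq_mul]; ring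
  rw [hsum]
  have hSQ : ∀ Q ∈ 𝒬, S.region ∪ Q ⊆ P := fun Q hQ' =>
    Set.union_subset hS fun z hz => (hQP Q hQ' hz).1
  apply le_antisymm
  · have hE : ∀ Q ∈ 𝒬, ∃ E : Finset Square, (E.card : ℤ) = opcs (S.region ∪ Q) - 1 ∧
        (∀ T ∈ E, IsValidSquare P T) ∧ Q ⊆ ⋃ T ∈ E, T.region := by
      intro Q hQ'
      obtain ⟨C, hC, hcard⟩ := hQ Q hQ'
      obtain ⟨T, hT, hvT⟩ := hC.exists_mem (Or.inl hvS)
      -- The square `T` at `v` lies in `S` and covers nothing of `Q`, so one square can be saved for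
      -- each piece and `S` paid for once.
      have hTS := hsub T ((hC.1 T hT).trans (hSQ Q hQ')) hvT
      refine ⟨C.erase T, ?_, fun U hU =>
        (hC.1 U (Finset.mem_of_mem_erase hU)).trans (hSQ Q hQ'), fun z hz => ?_⟩
      · rw [← hcard, ← Finset.card_erase_add_one hT]; push_cast; ring
      · obtain ⟨U, hU, hzU⟩ := hC.exists_mem (Or.inr hz)
        refine Set.mem_iUnion₂.2 ⟨U, Finset.mem_erase.2 ⟨?_, hU⟩, hzU⟩
        rintro rfl
        exact (hQP Q hQ' hz).2 (hTS hzU)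
    choose! E hEcard hEvalid hEcover using hE
    have hcov : IsCovering P (insert S (𝒬.biUnion E)) := by
      refine ⟨fun T hT => ?_, fun z hz => ?_⟩
      · rcases Finset.mem_insert.1 hT with rfl | hT
        · exact hS
        · obtain ⟨Q, hQ', hT⟩ := Finset.mem_biUnion.1 hT
          exact hEvalid Q hQ' T hT
      · by_cases hzS : z ∈ S.region
        · exact Set.mem_iUnion₂.2 ⟨S, Finset.mem_insert_self _ _, hzS⟩
        · obtain ⟨Q, hQ', hzQ⟩ := hcover z ⟨hz, hzS⟩
          obtain ⟨T, hT, hzT⟩ := Set.mem_iUnion₂.1 (hEcover Q hQ' hzQ)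
          exact Set.mem_iUnion₂.2 ⟨T, Finset.mem_insert_of_mem
            (Finset.mem_biUnion.2 ⟨Q, hQ', hT⟩), hzT⟩
    have h1 : opcs P ≤ 1 + ∑ Q ∈ 𝒬, (E Q).card := by
      refine (opcs_le hcov).trans ((Finset.card_insert_le _ _).trans ?_)
      rw [add_comm]
      exact Nat.add_le_add_left Finset.card_biUnion_le 1
    rw [← Finset.sum_congr rfl hEcard]
    exact_mod_cast h1
  · obtain ⟨D, hD, hcard⟩ := hP
    obtain ⟨T₀, hT₀, hvT₀⟩ := hD.exists_mem hv
    have hT₀S := hsub T₀ (hD.1 T₀ hT₀) hvT₀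
    -- Apart from `T₀`, each square that leaves `S` is charged to the piece that contains its part
    -- outside `S`; disjointness of the pieces prevents double charging.
    set E : Set (ℝ × ℝ) → Finset Square := fun Q => (D.erase T₀).filter fun T =>
      (T.region \ S.region).Nonempty ∧ T.region \ S.region ⊆ Q with hE
    have hcov : ∀ Q ∈ 𝒬, IsCovering (S.region ∪ Q) (insert S (E Q)) := by
      intro Q hQ'
      refine ⟨fun T hT => ?_, ?_⟩
      · rcases Finset.mem_insert.1 hT with rfl | hT
        · exact Set.subset_union_left
        · intro z hz
          by_cases hzS : z ∈ S.region
          · exact Or.inl hzS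
          · exact Or.inr ((Finset.mem_filter.1 hT).2.2 ⟨hz, hzS⟩)
      · rintro z (hz | hz)
        · exact Set.mem_iUnion₂.2 ⟨S, Finset.mem_insert_self _ _, hz⟩
        · have hzP := hQP Q hQ' hz
          obtain ⟨T, hT, hzT⟩ := hD.exists_mem hzP.1
          have hne : (T.region \ S.region).Nonempty := ⟨z, hzT, hzP.2⟩
          obtain ⟨Q', hQ'', hTQ⟩ := hsingle T (hD.1 T hT) hne
          obtain rfl := hdisj Q hQ' Q' hQ'' z hz (hTQ ⟨hzT, hzP.2⟩)
          refine Set.mem_iUnion₂.2 ⟨T, Finset.mem_insert_of_mem (Finset.mem_filter.2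
            ⟨Finset.mem_erase.2 ⟨?_, hT⟩, hne, hTQ⟩), hzT⟩
          rintro rfl
          exact hzP.2 (hT₀S hzT)
    have h1 : ∀ Q ∈ 𝒬, (opcs (S.region ∪ Q) : ℤ) - 1 ≤ (E Q).card := by
      intro Q hQ'
      have h := (opcs_le (hcov Q hQ')).trans (Finset.card_insert_le _ _)
      have : (opcs (S.region ∪ Q) : ℤ) ≤ (E Q).card + 1 := by exact_mod_cast h
      linarith
    have h2 : ∑ Q ∈ 𝒬, (E Q).card ≤ (D.erase T₀).card := by
      rw [← Finset.card_biUnion]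
      · exact Finset.card_le_card (Finset.biUnion_subset.2 fun Q _ => Finset.filter_subset _ _)
      · intro Q hQ' Q' hQ'' hne
        rw [Function.onFun, Finset.disjoint_left]
        intro T hT hT'
        obtain ⟨-, ⟨z, hz⟩, h3⟩ := Finset.mem_filter.1 hT
        exact hne (hdisj Q hQ' Q' hQ'' z (h3 hz) ((Finset.mem_filter.1 hT').2.2 hz))
    have h3 : ((D.erase T₀).card : ℤ) + 1 = opcs P := by
      rw [← hcard, ← Finset.card_erase_add_one hT₀]; push_cast; rfl
    have h4 : ∑ Q ∈ 𝒬, ((opcs (S.region ∪ Q) : ℤ) - 1) ≤ ((D.erase T₀).card : ℤ) :=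
      (Finset.sum_le_sum h1).trans (by exact_mod_cast h2)
    linarith

theorem mem_parts {P : Set (ℝ × ℝ)} {S : Square} {Q : Set (ℝ × ℝ)} :
    Q ∈ parts P S ↔ (∃ I ∈ types, part P S I = Q) ∧ Q.Nonempty := by
  simp [parts]

theorem HasType.unique {S : Square} {I J : Finset Side} {C : Set (ℝ × ℝ)} (hI : HasType S I C)
    (hJ : HasType S J C) : I = J :=
  Finset.ext fun d => (hI.1 d).symm.trans (hJ.1 d)

end

end OPCS

theorem lemma6 (P : Set (ℝ × ℝ)) (hP : OPCS.IsOrthogonalPolygon P)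
    (v : ℝ × ℝ) (hv : OPCS.IsNonKnobConvexVertex P v)
    (S : OPCS.Square) (hS : OPCS.IsMaximalCornerSquare P v S) :
    (∀ Q ∈ OPCS.parts P S, OPCS.IsOrthogonalPolygon (S.region ∪ Q)) ∧
      (OPCS.opcs P : ℤ) =
        (∑ Q ∈ OPCS.parts P S, (OPCS.opcs (S.region ∪ Q) : ℤ)) -
          (((OPCS.parts P S).card : ℤ) - 1) := by
  open OPCS in
  obtain ⟨F, hfin, rfl, hF, hFc⟩ := hP.exists_cells
  obtain ⟨a, b, n, p, q, hp, hq, hx, hy, hl, hbox⟩ := exists_isMaximalCornerBox hF hFc hv.1 hS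
  have hreg := Square.region_eq_cells hbox.pos hx hy hl
  have hpoly : ∀ Q ∈ parts (cells F) S, IsOrthogonalPolygon (S.region ∪ Q) := by
    intro Q hQ
    obtain ⟨⟨I, -, rfl⟩, -⟩ := mem_parts.1 hQ
    exact isOrthogonalPolygon_union hfin hF hFc hbox.pos hbox.sub hreg fun C hC => hC.1
  have hcomp : ∀ z ∈ cells F \ S.region, ∃ Q ∈ parts (cells F) S,
      connectedComponentIn (cells F \ S.region) z ⊆ Q := by
    intro z hz
    have hC : connectedComponentIn (cells F \ S.region) z ∈ components (cells F) S := ⟨z, hz, rfl⟩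
    obtain ⟨I, hI, hCI⟩ := exists_type hp hq hbox hx hy hl hC
    have hsub : connectedComponentIn (cells F \ S.region) z ⊆ part (cells F) S I :=
      Set.subset_sUnion_of_mem ⟨hC, hCI⟩
    exact ⟨_, mem_parts.2 ⟨⟨I, hI, rfl⟩, z, hsub (mem_connectedComponentIn hz)⟩, hsub⟩
  refine ⟨hpoly, opcs_decomposition (hS.1.1 hS.2) hS.2 hS.1.1
    (fun T hT hvT => hS.region_subset hv.1 hT hvT) _ hP.exists_covering
    (fun Q hQ => (hpoly Q hQ).exists_covering) ?_ ?_ ?_ ?_⟩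
  · intro Q hQ
    obtain ⟨⟨I, -, rfl⟩, -⟩ := mem_parts.1 hQ
    refine Set.sUnion_subset ?_
    rintro C ⟨⟨z, -, rfl⟩, -⟩
    exact connectedComponentIn_subset _ _
  · intro z hz
    obtain ⟨Q, hQ, hsub⟩ := hcomp z hz
    exact ⟨Q, hQ, hsub (mem_connectedComponentIn hz)⟩
  · intro Q hQ Q' hQ' z hz hz'
    obtain ⟨⟨I, -, rfl⟩, -⟩ := mem_parts.1 hQ
    obtain ⟨⟨J, -, rfl⟩, -⟩ := mem_parts.1 hQ'
    obtain ⟨C, ⟨⟨x, -, rfl⟩, hI⟩, hzC⟩ := hz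
    obtain ⟨C', ⟨⟨y, -, rfl⟩, hJ⟩, hzC'⟩ := hz'
    -- Both components contain `z`, so they coincide, and a component has only one type.
    rw [connectedComponentIn_eq hzC] at hI
    rw [connectedComponentIn_eq hzC'] at hJ
    rw [hI.unique hJ]
  · rintro T hT ⟨z, hz⟩
    have hsub : T.region \ S.region ⊆ cells F \ S.region := Set.sdiff_subset_sdiff_left hT
    obtain ⟨Q, hQ, h⟩ := hcomp z (hsub hz)
    exact ⟨Q, hQ, ((isPreconnected_region_diff T S).subset_connectedComponentIn hz hsub).trans h⟩
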